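/- Let $\omega=e^{2\pi i/3}$, $\Lambda=\mathrm{diag}(\omega,\omega^2,1)$, and let $u_0\in\mathcal S(\mathbb R)$ be real-valued. For $k\neq0$ put $$Q(x;k)=-\frac{2u_0(x)}{k}\begin{pmatrix}\omega^2&\omega&1\\ \omega^2&\omega&1\\ \omega^2&\omega&1\end{pmatrix},$$ write $e^{a\widehat\Lambda}A=e^{a\Lambda}Ae^{-a\Lambda}$, and let $J_+$ and $J_+^A$ denote the bounded continuous solutions (column by column, where these exist) of the Volterra equations $$J_+(x;k)=I-\int_x^\infty e^{(x-y)k\widehat\Lambda}(QJ_+)(y;k)\,dy,\qquad J_+^A(x;k)=I+\int_x^\infty e^{-(x-y)k\widehat\Lambda}(Q^TJ_+^A)(y;k)\,dy .$$ Let $$s(k)=I-\int_{\mathbb R}e^{-xk\widehat\Lambda}(QJ_+)(x;k)\,dx,\qquad s^A(k)=I+\int_{\mathbb R}e^{xk\widehat\Lambda}(Q^TJ_+^A)(x;k)\,dx,$$ where only the entries $s_{11},s_{12}$ for $k>0$ and $s^A_{11},s^A_{12}$ for $k<0$ are used. Assume that there are no spectral singularities, i.e. $s_{11}(k)\ne0$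 for all $k>0$ and $s^A_{11}(k)\neq0$ for all $k<0$, and that the behaviour at $k=0$ is generic, i.e. $k\,s_{11}(k)\not\to0$ as $k\downarrow0$ and $k\,s_{11}^A(k)\not\to0$ as $k\uparrow0$. Define $$r_1(k)=\frac{s_{12}(k)}{s_{11}(k)}\ (k>0),\qquad r_2(k)=\frac{s^A_{12}(k)}{s^A_{11}(k)}\ (k<0).$$ Then the first two columns of $J_+(\cdot;k)$ for $k>0$, and of $J_+^A(\cdot;k)$ for $k<0$, exist and are unique, so that $r_1$ and $r_2$ are well defined, and: 1. $r_1$ is smooth on $(0,\infty)$, $r_2$ is smooth on $(-\infty,0)$, and both are rapidly decreasing together with all derivatives: for all integers $m,n\ge0$, $(1+|k|)^m|\partial_k^n r_j(k)|$ is bounded on the domain of $r_j$. 2. $r_1$ extends to a smooth function on $[0,\infty)$ and $r_2$ to a smooth function on $(-\infty,0]$, and for every $N\ge0$ $$r_j(k)=\sum_{n=0}^N\frac{r_j^{(n)}(0)}{n!}k^n+O(k^{N+1}),\qquad k\to0,$$ in the domain of $r_j$, with one-sided derivatives at $0$; moreover $r_1(0)=\omega^2$ and $r_2(0)=1$, so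 $|r_1(0)|=|r_2(0)|=1$. -/

import Mathlib

open Set Filter Topology MeasureTheory
open scoped ContDiff SchwartzMap

namespace SawadaKotera

noncomputable section

/-- The primitive cube root of unity `ω = exp (2πi/3)`. -/
def om : ℂ := Complex.exp (2 * Real.pi * Complex.I / 3)

/-- The diagonal entries of `Λ = diag (ω, ω², 1)`. -/
def lam : Fin 3 → ℂ := ![om, om ^ 2, 1]

/-- The potential matrix `Q(x;k)` of the diagonalized spatial Lax equation
`Ψ_x = (kΛ + Q) Ψ` of the Sawada–Kotera equation. -/
def Q (u : ℝ → ℝ) (k : ℂ) (x : ℝ) : Matrix (Fin 3) (Fin 3) ℂ :=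
  (-(2 * (u x : ℂ)) / k) • !![om ^ 2, om, 1; om ^ 2, om, 1; om ^ 2, om, 1]

/-- `v` is the `j`-th column of the Jost function `J₊(·;k)`: a bounded continuous solution of the
`j`-th column of the Volterra equation
`J₊(x;k) = I - ∫_x^∞ e^{(x-y)kΛ} (Q J₊)(y;k) e^{-(x-y)kΛ} dy`.
(The exponentials have modulus at most one for `k > 0` and the first two columns, so there the
integrals converge absolutely.) -/
def IsJostColumn (u : ℝ → ℝ) (k : ℂ) (j : Fin 3) (v : ℝ → Fin 3 → ℂ) : Prop :=
  Continuous v ∧ (∃ C : ℝ, ∀ x, ‖v x‖ ≤ C) ∧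
    ∀ (x : ℝ) (i : Fin 3), v x i = (1 : Matrix (Fin 3) (Fin 3) ℂ) i j -
      ∫ y in Ioi x, Complex.exp (((x - y : ℝ) : ℂ) * k * (lam i - lam j)) *
        (Q u k y).mulVec (v y) i

/-- `v` is the `j`-th column of the cofactor Jost function `J₊ᴬ(·;k)`: a bounded continuous
solution of the `j`-th column of the Volterra equation
`J₊ᴬ(x;k) = I + ∫_x^∞ e^{-(x-y)kΛ} (Qᵀ J₊ᴬ)(y;k) e^{(x-y)kΛ} dy`.
(The exponentials have modulus at most one for `k < 0` and the first two columns.) -/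
def IsCofactorJostColumn (u : ℝ → ℝ) (k : ℂ) (j : Fin 3) (v : ℝ → Fin 3 → ℂ) : Prop :=
  Continuous v ∧ (∃ C : ℝ, ∀ x, ‖v x‖ ≤ C) ∧
    ∀ (x : ℝ) (i : Fin 3), v x i = (1 : Matrix (Fin 3) (Fin 3) ℂ) i j +
      ∫ y in Ioi x, Complex.exp (-(((x - y : ℝ) : ℂ) * k * (lam i - lam j))) *
        (Q u k y).transpose.mulVec (v y) i

open Classical in
/-- The `j`-th column of `J₊(·;k)` (zero where the Volterra equation has no solution). -/
def jostColumn (u : ℝ → ℝ) (k : ℂ) (j : Fin 3) : ℝ → Fin 3 → ℂ :=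
  if h : ∃ v, IsJostColumn u k j v then Classical.choose h else 0

open Classical in
/-- The `j`-th column of `J₊ᴬ(·;k)` (zero where the Volterra equation has no solution). -/
def cofactorJostColumn (u : ℝ → ℝ) (k : ℂ) (j : Fin 3) : ℝ → Fin 3 → ℂ :=
  if h : ∃ v, IsCofactorJostColumn u k j v then Classical.choose h else 0

/-- The entries of the scattering matrix `s(k) = I - ∫_ℝ e^{-xkΛ} (Q J₊)(x;k) e^{xkΛ} dx`.
Rows and columns are numbered `0, 1, 2`. -/
def s (u : ℝ → ℝ) (k : ℂ) (i j : Fin 3) : ℂ :=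
  (1 : Matrix (Fin 3) (Fin 3) ℂ) i j -
    ∫ x : ℝ, Complex.exp (-((x : ℂ) * k * (lam i - lam j))) *
      (Q u k x).mulVec (jostColumn u k j x) i

/-- The entries of the cofactor scattering matrix
`sᴬ(k) = I + ∫_ℝ e^{xkΛ} (Qᵀ J₊ᴬ)(x;k) e^{-xkΛ} dx`. Rows and columns are numbered `0, 1, 2`. -/
def sA (u : ℝ → ℝ) (k : ℂ) (i j : Fin 3) : ℂ :=
  (1 : Matrix (Fin 3) (Fin 3) ℂ) i j +
    ∫ x : ℝ, Complex.exp ((x : ℂ) * k * (lam i - lam j)) *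
      (Q u k x).transpose.mulVec (cofactorJostColumn u k j x) i

/-- The reflection coefficient `r₁ = s₁₂ / s₁₁`, meant for `k > 0`. -/
def r₁ (u : ℝ → ℝ) (k : ℝ) : ℂ := s u k 0 1 / s u k 0 0

/-- The reflection coefficient `r₂ = sᴬ₁₂ / sᴬ₁₁`, meant for `k < 0`. -/
def r₂ (u : ℝ → ℝ) (k : ℝ) : ℂ := sA u k 0 1 / sA u k 0 0

/-- `r` is smooth on the open half-line `D` and rapidly decreasing there, with all its
derivatives. -/
def SmoothRapidlyDecreasingOn (r : ℝ → ℂ) (D : Set ℝ) : Prop :=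
  ContDiffOn ℝ ∞ r D ∧
    ∀ m n : ℕ, ∃ C : ℝ, ∀ k ∈ D, (1 + |k|) ^ m * ‖iteratedDeriv n r k‖ ≤ C

/-- `r`, given on the open half-line `D` with end point `0`, extends to a function `R` on `D ∪ {0}`
that is smooth up to `0`, has the value `c`, of modulus one, at `0`, and is asymptotic to its Taylor series
`R(0) + R'(0) k + R''(0) k² / 2 + ⋯` as `k → 0` in `D`. -/
def ExtendsSmoothlyToZeroUnimodular (r : ℝ → ℂ) (D : Set ℝ) (c : ℂ) : Prop :=
  ∃ R : ℝ → ℂ, EqOn R r D ∧ ContDiffOn ℝ ∞ R (insert 0 D) ∧ R 0 = c ∧ ‖R 0‖ = 1 ∧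
    ∀ N : ℕ,
      (fun k : ℝ => r k - ∑ n ∈ Finset.range (N + 1),
        iteratedDerivWithin n R (insert 0 D) 0 / (n.factorial : ℂ) * (k : ℂ) ^ n)
      =O[𝓝[D] 0] fun k : ℝ => k ^ (N + 1)

end

end SawadaKotera

/-! The matrix `Q` has rank one: it is `-(2u/k)` times the column `(1,1,1)` times the row `(λ₀²,
λ₁², λ₂²)`. Hence the `j`-th Jost column `v` is determined by the scalar density `F = ∑ λᵢ² vᵢ`,
which solves a scalar Volterra equation with kernel `(2/k) ∑ λᵢ² e^{-(y-x)k(λᵢ-λⱼ)} u(y)` on `y >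
x`. Since `∑ λᵢ² = 0`, the pole at `k = 0` cancels: the kernel is `2 (y-x) σ((y-x)k) u(y)` with `σ`
= `volterraSymbol j 0` entire. For `j ≠ 2` all exponents have `Re (λᵢ-λⱼ) ≥ 0`, so `σ` and its
derivatives are bounded on `[0,∞)`.

Each `k`-derivative costs one power of `y-x`, which the decay of `u` absorbs once that decay is
shared between the two variables. After this conjugation, and a further weight `e^{-l arctan x}`
that makes the operator a contraction uniformly in `k ≥ 0`, the kernel is smooth in `k` in the
supremum norm. So is the resolvent, and therefore so is `Gⱼ(k) = k (s₁ⱼ(k) - δ₁ⱼ)`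
(`scatteringIntegral`), with all derivatives bounded on `[0,∞)`
(`boundedDerivs_scatteringIntegral`).

In the indices `0, 1, 2` of the code, `r₁ = G₁ / (k + G₀)`. The two hypotheses on `s₁₁` keep the
denominator away from zero on `[0,∞)`, which gives smoothness up to `0` with bounded derivatives.
Rapid decay of `G₁` comes from repeated integration by parts (`oscIntegral_decay`), and decay of the
derivatives follows by interpolation (`RapidDecay.derivWithin`). At `k = 0` the kernel does not
depend on `j`, so the densities are proportional to `λⱼ²` and `r₁(0) = λ₁²/λ₀² = ω²`.

Finally `Qᵀ` is conjugate to `Q` by `Λ²`, which turns the cofactor problem at `k` into the original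
one at `-k` and yields `r₂(k) = ω r₁(-k)`. -/

namespace SawadaKotera

open scoped BoundedContinuousFunction

noncomputable section

/-! ### Functions with bounded derivatives on a set, valued in a normed space. -/

section BoundedDerivatives

variable {E F G : Type*} [NormedAddCommGroup E] [NormedSpace ℝ E] [NormedAddCommGroup F]
  [NormedSpace ℝ F] [NormedAddCommGroup G] [NormedSpace ℝ G]

/-- `f` has derivatives within `s` up to order `n`, all of them bounded on `s`. -/
def BoundedDerivs (s : Set ℝ) : ℕ → (ℝ → E) → Prop
  | 0, f => ∃ C, ∀ k ∈ s, ‖f k‖ ≤ C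
  | n + 1, f => (∃ C, ∀ k ∈ s, ‖f k‖ ≤ C) ∧
      ∃ f' : ℝ → E, (∀ k ∈ s, HasDerivWithinAt f (f' k) s k) ∧ BoundedDerivs s n f'

variable {s : Set ℝ} {n : ℕ}

theorem BoundedDerivs.bounded {f : ℝ → E} (h : BoundedDerivs s n f) :
    ∃ C, ∀ k ∈ s, ‖f k‖ ≤ C := by
  cases n with
  | zero => exact h
  | succ n => exact h.1

theorem BoundedDerivs.of_succ {f : ℝ → E} (h : BoundedDerivs s (n + 1) f) :
    BoundedDerivs s n f := by
  induction n generalizing f with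
  | zero => exact h.1
  | succ n ih =>
    obtain ⟨hb, f', hf', h'⟩ := h
    exact ⟨hb, f', hf', ih h'⟩

theorem BoundedDerivs.congr {f g : ℝ → E} (h : BoundedDerivs s n f) (hfg : EqOn g f s) :
    BoundedDerivs s n g := by
  have hb : ∃ C, ∀ k ∈ s, ‖g k‖ ≤ C := by
    obtain ⟨C, hC⟩ := h.bounded
    exact ⟨C, fun k hk => by rw [hfg hk]; exact hC k hk⟩
  cases n with
  | zero => exact hb
  | succ n =>
    obtain ⟨-, f', hf', h'⟩ := h
    exact ⟨hb, f', fun k hk => (hf' k hk).congr (fun x hx => hfg hx) (hfg hk), h'⟩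

theorem boundedDerivs_const (c : E) : BoundedDerivs s n (fun _ : ℝ => c) := by
  induction n generalizing c with
  | zero => exact ⟨‖c‖, fun _ _ => le_rfl⟩
  | succ n ih =>
    exact ⟨⟨‖c‖, fun _ _ => le_rfl⟩, fun _ => 0, fun k _ => hasDerivWithinAt_const k s c, ih 0⟩

theorem BoundedDerivs.add {f g : ℝ → E} (hf : BoundedDerivs s n f) (hg : BoundedDerivs s n g) :
    BoundedDerivs s n (fun k => f k + g k) := by
  have hb : ∃ C, ∀ k ∈ s, ‖f k + g k‖ ≤ C := by
    obtain ⟨C, hC⟩ := hf.bounded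
    obtain ⟨D, hD⟩ := hg.bounded
    exact ⟨C + D, fun k hk => (norm_add_le _ _).trans (add_le_add (hC k hk) (hD k hk))⟩
  induction n generalizing f g with
  | zero => exact hb
  | succ n ih =>
    obtain ⟨-, f', hf', Hf⟩ := hf
    obtain ⟨-, g', hg', Hg⟩ := hg
    refine ⟨hb, fun k => f' k + g' k, fun k hk => (hf' k hk).add (hg' k hk), ih Hf Hg ?_⟩
    obtain ⟨C, hC⟩ := Hf.bounded
    obtain ⟨D, hD⟩ := Hg.bounded
    exact ⟨C + D, fun k hk => (norm_add_le _ _).trans (add_le_add (hC k hk) (hD k hk))⟩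

theorem BoundedDerivs.clm {f : ℝ → E} (hf : BoundedDerivs s n f) (L : E →L[ℝ] F) :
    BoundedDerivs s n (fun k => L (f k)) := by
  induction n generalizing f with
  | zero =>
    obtain ⟨C, hC⟩ := hf.bounded
    exact ⟨‖L‖ * C, fun k hk => L.le_opNorm_of_le (hC k hk)⟩
  | succ n ih =>
    obtain ⟨C, hC⟩ := hf.bounded
    obtain ⟨-, f', hf', Hf⟩ := hf
    exact ⟨⟨‖L‖ * C, fun k hk => L.le_opNorm_of_le (hC k hk)⟩, fun k => L (f' k),
      fun k hk => L.hasFDerivAt.comp_hasDerivWithinAt k (hf' k hk), ih Hf⟩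

theorem BoundedDerivs.neg {f : ℝ → E} (hf : BoundedDerivs s n f) :
    BoundedDerivs s n (fun k => -f k) :=
  hf.clm (-(ContinuousLinearMap.id ℝ E))

theorem BoundedDerivs.bilinear {f : ℝ → E} {g : ℝ → F} (B : E →L[ℝ] F →L[ℝ] G)
    (hf : BoundedDerivs s n f) (hg : BoundedDerivs s n g) :
    BoundedDerivs s n (fun k => B (f k) (g k)) := by
  have hb : ∀ {f : ℝ → E} {g : ℝ → F}, (∃ C, ∀ k ∈ s, ‖f k‖ ≤ C) →
      (∃ C, ∀ k ∈ s, ‖g k‖ ≤ C) → ∃ C, ∀ k ∈ s, ‖B (f k) (g k)‖ ≤ C := by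
    rintro f g ⟨C, hC⟩ ⟨D, hD⟩
    refine ⟨‖B‖ * C * D, fun k hk => (B.le_opNorm₂ _ _).trans ?_⟩
    have := hC k hk
    have := hD k hk
    have : 0 ≤ C := (norm_nonneg _).trans (hC k hk)
    gcongr
  induction n generalizing f g with
  | zero => exact hb hf hg
  | succ n ih =>
    have hf0 := hf.of_succ
    have hg0 := hg.of_succ
    obtain ⟨bf, f', hf', Hf⟩ := hf
    obtain ⟨bg, g', hg', Hg⟩ := hg
    exact ⟨hb bf bg, fun k => B (f k) (g' k) + B (f' k) (g k),
      fun k hk => B.hasDerivWithinAt_of_bilinear (hf' k hk) (hg' k hk),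
      (ih hf0 Hg).add (ih Hf hg0)⟩

/-- The derivative of the inverse is `-f⁻¹ f' f⁻¹`, so order `n + 1` for the inverse needs only
order `n` for the inverse and for `f'`. The bound on the inverse itself is a genuine extra
hypothesis. -/
theorem boundedDerivs_ringInverse {A : Type*} [NormedRing A] [NormedAlgebra ℝ A] [CompleteSpace A]
    {f f' : ℝ → A} (hf : ∀ k ∈ s, HasDerivWithinAt f (f' k) s k)
    (hf' : BoundedDerivs s n f') (hu : ∀ k ∈ s, IsUnit (f k))
    (hb : ∃ C, ∀ k ∈ s, ‖Ring.inverse (f k)‖ ≤ C) :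
    BoundedDerivs s n (fun k => Ring.inverse (f k)) := by
  induction n with
  | zero => exact hb
  | succ n ih =>
    have h0 := ih hf'.of_succ
    refine ⟨hb, fun k => -(Ring.inverse (f k) * f' k * Ring.inverse (f k)), fun k hk => ?_, ?_⟩
    · obtain ⟨v, hv⟩ := hu k hk
      have h1 := hasFDerivAt_ringInverse (𝕜 := ℝ) v
      have h2 := h1.comp_hasDerivWithinAt_of_eq k (hf k hk) hv
      simpa [← hv, Function.comp_def] using! h2
    · have h1 := (h0.bilinear (ContinuousLinearMap.mul ℝ A) hf'.of_succ).bilinear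
        (ContinuousLinearMap.mul ℝ A) h0
      exact h1.neg

/-- One order is lost at each level, because a bounded top derivative need not be continuous; this
is immaterial for smoothness. -/
theorem BoundedDerivs.contDiffOn {f : ℝ → E} (hs : UniqueDiffOn ℝ s)
    (h : ∀ n, BoundedDerivs s n f) : ContDiffOn ℝ ∞ f s := by
  have key : ∀ (n : ℕ) (f : ℝ → E), BoundedDerivs s (n + 1) f → ContDiffOn ℝ n f s := by
    intro n
    induction n with
    | zero =>
      rintro f ⟨-, f', hf', -⟩
      exact contDiffOn_zero.2 fun k hk => (hf' k hk).continuousWithinAt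
    | succ n ih =>
      rintro f ⟨-, f', hf', Hf⟩
      have := (contDiffOn_succ_iff_derivWithin (n := (n : WithTop ℕ∞)) (f := f) hs).2
        ⟨fun k hk => (hf' k hk).differentiableWithinAt, by simp,
          ih _ (Hf.congr fun k hk => (hf' k hk).derivWithin (hs k hk))⟩
      exact_mod_cast this
  exact contDiffOn_infty.2 fun n => key n f (h (n + 1))

theorem BoundedDerivs.derivWithin {f : ℝ → E} (hs : UniqueDiffOn ℝ s)
    (h : BoundedDerivs s (n + 1) f) : BoundedDerivs s n (derivWithin f s) := by
  obtain ⟨-, f', hf', Hf⟩ := h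
  exact Hf.congr fun k hk => (hf' k hk).derivWithin (hs k hk)

theorem BoundedDerivs.differentiableOn {f : ℝ → E} (h : BoundedDerivs s (n + 1) f) :
    DifferentiableOn ℝ f s := by
  obtain ⟨-, f', hf', -⟩ := h
  exact fun k hk => (hf' k hk).differentiableWithinAt

/-- First order Taylor estimate on a convex set. -/
theorem norm_sub_sub_smul_le {f f' f'' : ℝ → E} {C : ℝ} (hs : Convex ℝ s)
    (hf : ∀ k ∈ s, HasDerivWithinAt f (f' k) s k)
    (hf' : ∀ k ∈ s, HasDerivWithinAt f' (f'' k) s k) (hC : ∀ k ∈ s, ‖f'' k‖ ≤ C)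
    {k l : ℝ} (hk : k ∈ s) (hl : l ∈ s) :
    ‖f l - f k - (l - k) • f' k‖ ≤ C * |l - k| ^ 2 := by
  have hC0 : 0 ≤ C := (norm_nonneg _).trans (hC k hk)
  have hsub : segment ℝ k l ⊆ s := hs.segment_subset hk hl
  have h1 : ∀ t ∈ segment ℝ k l,
      HasDerivWithinAt (fun t => f t - t • f' k) (f' t - f' k) (segment ℝ k l) t := by
    intro t ht
    have := (hf t (hsub ht)).mono hsub
    simpa using! this.sub ((hasDerivWithinAt_id t _).smul_const (f' k))
  have h2 : ∀ t ∈ segment ℝ k l, ‖f' t - f' k‖ ≤ C * |l - k| := by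
    intro t ht
    have h3 := hs.norm_image_sub_le_of_norm_hasDerivWithin_le hf' hC hk (hsub ht)
    refine h3.trans ?_
    gcongr
    have := norm_sub_le_of_mem_segment ht
    rw [Real.norm_eq_abs, ← Real.norm_eq_abs (l - k)]
    simpa using this
  have h4 := (convex_segment k l).norm_image_sub_le_of_norm_hasDerivWithin_le h1 h2
    (left_mem_segment ℝ k l) (right_mem_segment ℝ k l)
  calc ‖f l - f k - (l - k) • f' k‖ = ‖(f l - l • f' k) - (f k - k • f' k)‖ := by
        congr 1; rw [sub_smul]; abel
    _ ≤ _ := h4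
    _ = _ := by rw [Real.norm_eq_abs]; ring

/-- A sequence of uniformly bounded functions, each of which is the pointwise derivative of its
predecessor, is differentiable in the supremum norm. -/
theorem boundedDerivs_of_pointwise {Z : Type*} [TopologicalSpace Z] (hs : Convex ℝ s)
    (N : ℕ → ℝ → Z →ᵇ ℂ) (hN : ∀ n, ∃ C, ∀ k ∈ s, ‖N n k‖ ≤ C)
    (hd : ∀ n, ∀ z, ∀ k ∈ s, HasDerivWithinAt (fun t => N n t z) (N (n + 1) k z) s k) (n : ℕ) :
    BoundedDerivs s n (N 0) := by
  have key : ∀ m, ∀ k ∈ s, HasDerivWithinAt (N m) (N (m + 1) k) s k := by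
    intro m k hk
    obtain ⟨C, hC⟩ := hN (m + 2)
    have hC0 : 0 ≤ C := (norm_nonneg _).trans (hC k hk)
    -- The second derivative is bounded by `C` at every point `z`, so the pointwise Taylor remainder
    -- is quadratic uniformly in `z`, that is, in the supremum norm.
    have h1 : ∀ l ∈ s, ‖N m l - N m k - (l - k) • N (m + 1) k‖ ≤ C * ‖(l - k) ^ 2‖ := by
      intro l hl
      refine (BoundedContinuousFunction.norm_le (by positivity)).2 fun z => ?_
      have := norm_sub_sub_smul_le hs (hd m z) (hd (m + 1) z)
        (fun t ht => (BoundedContinuousFunction.norm_coe_le_norm _ z).trans (hC t ht)) hk hl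
      simpa using this
    rw [hasDerivWithinAt_iff_isLittleO]
    refine (Asymptotics.IsBigO.of_bound C ?_).trans_isLittleO
      (g := fun l => (l - k) ^ 2) ?_
    · filter_upwards [self_mem_nhdsWithin] with l hl using h1 l hl
    · have h2 : (fun l : ℝ => (l - k) ^ 2) =o[𝓝 k] fun l => (l - k) ^ 1 :=
        Asymptotics.IsLittleO.comp_tendsto (g := fun x : ℝ => x ^ 1)
          (Asymptotics.isLittleO_pow_pow one_lt_two)
          (by simpa using (continuous_id.sub continuous_const).tendsto (f := fun l : ℝ => l - k) k)
      simpa using h2.mono nhdsWithin_le_nhds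
  have all : ∀ n m, BoundedDerivs s n (N m) := by
    intro n
    induction n with
    | zero => exact hN
    | succ n ih => exact fun m => ⟨hN m, N (m + 1), key m, ih (m + 1)⟩
  exact all n 0

end BoundedDerivatives

/-! ### Rapid decay passes to derivatives. -/

section RapidDecay

/-- `f` decays on `[0, ∞)` faster than every power. -/
def RapidDecay (f : ℝ → ℂ) : Prop :=
  ∀ m : ℕ, ∃ C : ℝ, ∀ k ∈ Ici (0 : ℝ), (1 + k) ^ m * ‖f k‖ ≤ C

/-- Landau-type interpolation: `h f'(k) = f(k+h) - f(k) + O(h²)` when `f''` is bounded, and a step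
`h` that shrinks with `k` trades decay of `f` for decay of `f'`. -/
theorem RapidDecay.derivWithin {f : ℝ → ℂ} (hf : RapidDecay f)
    (hb : BoundedDerivs (Ici 0) 2 f) : RapidDecay (derivWithin f (Ici 0)) := by
  have hu : UniqueDiffOn ℝ (Ici (0 : ℝ)) := uniqueDiffOn_Ici 0
  have hb1 := hb.derivWithin hu
  obtain ⟨C, hC⟩ := (hb1.derivWithin hu).bounded
  intro m
  obtain ⟨D, hD⟩ := hf (2 * m)
  refine ⟨C + 2 * D, fun k hk => ?_⟩
  have hk0 : (0 : ℝ) ≤ k := hk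
  -- With `p = (1+k)^m = 1/h`, multiplying the Taylor estimate by `p²` gives `p |f'| ≤ p² |f(k+h)| +
  -- p² |f(k)| + C`; this is why decay of `f` of order `2m` is used. The step goes to the right and
  -- stays in the half-line.
  set h : ℝ := ((1 + k) ^ m)⁻¹ with hh
  have hp : 0 < (1 + k) ^ m := by positivity
  have hpos : 0 < h := by positivity
  have hl : k + h ∈ Ici (0 : ℝ) := by simp only [mem_Ici]; positivity
  have h1 := norm_sub_sub_smul_le (convex_Ici (0 : ℝ))
    (fun t ht => (hb.differentiableOn t ht).hasDerivWithinAt)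
    (fun t ht => (hb1.differentiableOn t ht).hasDerivWithinAt) hC hk hl
  have h2 : (1 + k) ^ (2 * m) * ‖f (k + h)‖ ≤ D := by
    refine le_trans ?_ (hD _ hl)
    gcongr
    linarith
  have h3 := hD k hk
  rw [add_sub_cancel_left, abs_of_pos hpos] at h1
  have h4 : ‖h • _root_.derivWithin f (Ici 0) k‖ ≤ ‖f (k + h)‖ + ‖f k‖ + C * h ^ 2 := by
    have e : h • _root_.derivWithin f (Ici 0) k
        = f (k + h) - f k - (f (k + h) - f k - h • _root_.derivWithin f (Ici 0) k) := by abel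
    rw [e]
    exact (norm_sub_le _ _).trans (add_le_add (norm_sub_le _ _) h1)
  rw [norm_smul, Real.norm_eq_abs, abs_of_pos hpos] at h4
  have hph : (1 + k) ^ m * h = 1 := mul_inv_cancel₀ hp.ne'
  have e : (1 + k) ^ (2 * m) = (1 + k) ^ m * (1 + k) ^ m := by ring
  rw [e] at h2 h3
  set p := (1 + k) ^ m
  set d := ‖_root_.derivWithin f (Ici 0) k‖
  have h5 : p * p * (h * d) ≤ p * p * (‖f (k + h)‖ + ‖f k‖ + C * h ^ 2) :=
    mul_le_mul_of_nonneg_left h4 (by positivity)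
  have e1 : p * p * (h * d) = p * d := by
    calc p * p * (h * d) = (p * h) * (p * d) := by ring
      _ = p * d := by rw [hph, one_mul]
  have e2 : p * p * (C * h ^ 2) = C := by
    calc p * p * (C * h ^ 2) = C * (p * h) ^ 2 := by ring
      _ = C := by rw [hph]; ring
  nlinarith

theorem RapidDecay.bound_iteratedDeriv {f : ℝ → ℂ} (hf : RapidDecay f)
    (hb : ∀ n, BoundedDerivs (Ici 0) n f) (m n : ℕ) :
    ∃ C : ℝ, ∀ k ∈ Ioi (0 : ℝ), (1 + k) ^ m * ‖iteratedDeriv n f k‖ ≤ C := by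
  induction n generalizing f with
  | zero =>
    obtain ⟨C, hC⟩ := hf m
    exact ⟨C, fun k hk => by simpa using hC k (mem_Ici.2 (mem_Ioi.1 hk).le)⟩
  | succ n ih =>
    obtain ⟨C, hC⟩ := ih (hf.derivWithin (hb 2)) fun n =>
      (hb (n + 1)).derivWithin (uniqueDiffOn_Ici 0)
    refine ⟨C, fun k hk => ?_⟩
    have : iteratedDeriv (n + 1) f k = iteratedDeriv n (_root_.derivWithin f (Ici 0)) k := by
      rw [iteratedDeriv_succ']
      -- At an interior point the one-sided and the two-sided derivatives agree on a whole
      -- neighbourhood, hence so do their iterates.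
      refine Filter.EventuallyEq.iteratedDeriv_eq n ?_
      filter_upwards [Ioi_mem_nhds hk] with t ht
      exact (derivWithin_of_mem_nhds (Ici_mem_nhds ht)).symm
    rw [this]
    exact hC k hk

end RapidDecay

/-! ### Algebra of the cube roots of unity. -/

section CubeRoots

theorem om_eq : om = -1 / 2 + (Real.sqrt 3 / 2 : ℝ) * Complex.I := by
  have h : (2 * Real.pi * Complex.I / 3 : ℂ) = ((Real.pi - Real.pi / 3 : ℝ) : ℂ) * Complex.I := by
    push_cast; ring
  rw [om, h, Complex.exp_mul_I, ← Complex.ofReal_cos, ← Complex.ofReal_sin, Real.cos_pi_sub,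
    Real.sin_pi_sub, Real.cos_pi_div_three, Real.sin_pi_div_three]
  push_cast; ring

theorem om_cube : om ^ 3 = 1 := by
  rw [om, ← Complex.exp_nat_mul, ← Complex.exp_two_pi_mul_I]
  congr 1; push_cast; ring

theorem one_add_om : 1 + om + om ^ 2 = 0 := by
  have h3 : ((Real.sqrt 3 : ℝ) : ℂ) ^ 2 = 3 := by
    rw [← Complex.ofReal_pow, Real.sq_sqrt (by norm_num)]; norm_num
  rw [om_eq]
  push_cast
  linear_combination (1 / 4) * Complex.I ^ 2 * h3 + (3 / 4) * Complex.I_sq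

theorem om_ne_zero : om ≠ 0 := Complex.exp_ne_zero _

theorem norm_om : ‖om‖ = 1 := by
  have : (2 * Real.pi * Complex.I / 3 : ℂ) = ((2 * Real.pi / 3 : ℝ) : ℂ) * Complex.I := by
    push_cast; ring
  rw [om, this, Complex.norm_exp_ofReal_mul_I]

theorem om_re : om.re = -1 / 2 := by simp [om_eq]

theorem om_sq : om ^ 2 = -1 - om := by linear_combination one_add_om

@[simp] theorem lam_zero : lam 0 = om := rfl
@[simp] theorem lam_one : lam 1 = om ^ 2 := rfl
@[simp] theorem lam_two : lam 2 = 1 := rfl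

theorem norm_lam (i : Fin 3) : ‖lam i‖ = 1 := by
  fin_cases i <;> simp [norm_om]

theorem lam_ne_zero (i : Fin 3) : lam i ≠ 0 := by
  rw [← norm_ne_zero_iff, norm_lam]; exact one_ne_zero

theorem norm_lam_sub_le (i j : Fin 3) : ‖lam i - lam j‖ ≤ 2 := by
  refine (norm_sub_le _ _).trans ?_
  rw [norm_lam, norm_lam]; norm_num

/-- `λ₀` and `λ₁` share the minimal real part `-1/2`. This is what makes the exponentials of the
first two columns bounded for `y ≥ x` and `k ≥ 0`. -/
theorem lam_sub_re_nonneg (i : Fin 3) {j : Fin 3} (hj : j ≠ 2) : 0 ≤ (lam i - lam j).re := by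
  fin_cases i <;> fin_cases j <;> simp_all [om_sq, om_re] <;> norm_num

/-- The cancellation that removes the pole of the scalar kernel at `k = 0`. -/
theorem sum_lam_sq : ∑ i, lam i ^ 2 = 0 := by
  simp only [Fin.sum_univ_three, lam_zero, lam_one, lam_two]
  linear_combination one_add_om + om * om_cube

theorem sum_lam_cube : ∑ i, lam i ^ 3 = 3 := by
  simp only [Fin.sum_univ_three, lam_zero, lam_one, lam_two]
  linear_combination (2 + om ^ 3) * om_cube

/-- In the entries `s₁₁` and `s₁₂` the exponential is therefore unimodular on all of `ℝ`. -/
theorem lam_zero_sub_lam_re {j : Fin 3} (hj : j ≠ 2) : (lam 0 - lam j).re = 0 := by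
  fin_cases j <;> simp_all [om_sq, om_re]; norm_num

end CubeRoots

/-! ### The regularized symbol of the scalar Volterra kernel. -/

section Kernel

/-- The `n`-th derivative of `z ↦ ∫_0^1 e^{-tzα} dt`. -/
def expMoment (α : ℂ) (n : ℕ) (z : ℝ) : ℂ :=
  ∫ t in (0 : ℝ)..1, (-((t : ℂ) * α)) ^ n * Complex.exp (-((t : ℂ) * z * α))

theorem continuous_expMoment_integrand (α : ℂ) (n : ℕ) (z : ℝ) :
    Continuous fun t : ℝ => (-((t : ℂ) * α)) ^ n * Complex.exp (-((t : ℂ) * z * α)) := by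
  fun_prop

theorem hasDerivAt_expMoment (α : ℂ) (n : ℕ) (z : ℝ) :
    HasDerivAt (expMoment α n) (expMoment α (n + 1) z) z := by
  refine (intervalIntegral.hasDerivAt_integral_of_dominated_loc_of_deriv_le
    (F := fun z t => (-((t : ℂ) * α)) ^ n * Complex.exp (-((t : ℂ) * (z : ℝ) * α)))
    (F' := fun z t => (-((t : ℂ) * α)) ^ (n + 1) * Complex.exp (-((t : ℂ) * (z : ℝ) * α)))
    (bound := fun _ => ‖α‖ ^ (n + 1) * Real.exp ((|z| + 1) * ‖α‖)) (s := Metric.ball z 1)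
    (Metric.ball_mem_nhds z one_pos) ?_ ?_ ?_ ?_ ?_ ?_).2
  · exact Eventually.of_forall fun w =>
      (continuous_expMoment_integrand α n w).aestronglyMeasurable
  · exact (continuous_expMoment_integrand α n z).intervalIntegrable _ _
  · exact (continuous_expMoment_integrand α (n + 1) z).aestronglyMeasurable
  · refine Eventually.of_forall fun t ht w hw => ?_
    rw [uIoc_of_le zero_le_one] at ht
    have ht1 : |t| ≤ 1 := by rw [abs_of_pos ht.1]; exact ht.2
    have hw1 : |w| ≤ |z| + 1 := by
      rw [Metric.mem_ball, Real.dist_eq] at hw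
      have := abs_sub_abs_le_abs_sub w z
      linarith
    rw [norm_mul, norm_pow, norm_neg, norm_mul, Complex.norm_real, Real.norm_eq_abs]
    have e1 : ‖Complex.exp (-((t : ℂ) * (w : ℝ) * α))‖ ≤ Real.exp ((|z| + 1) * ‖α‖) := by
      refine (Complex.norm_exp_le_exp_norm _).trans (Real.exp_le_exp.2 ?_)
      rw [norm_neg, norm_mul, norm_mul, Complex.norm_real, Complex.norm_real, Real.norm_eq_abs,
        Real.norm_eq_abs]
      gcongr
      calc |t| * |w| ≤ 1 * (|z| + 1) := by gcongr
        _ = _ := one_mul _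
    have e2 : |t| * ‖α‖ ≤ ‖α‖ := mul_le_of_le_one_left (norm_nonneg _) ht1
    gcongr
  · exact intervalIntegrable_const
  · refine Eventually.of_forall fun t _ w _ => ?_
    have h1 : HasDerivAt (fun w : ℝ => -((t : ℂ) * (w : ℝ) * α)) (-((t : ℂ) * α)) w := by
      have := ((((Complex.ofRealCLM.hasDerivAt (x := w)).const_mul (t : ℂ))).mul_const α).neg
      simpa using! this
    have := (h1.cexp).const_mul ((-((t : ℂ) * α)) ^ n)
    convert! this using 1
    ring

theorem norm_expMoment_le {α : ℂ} (hα : 0 ≤ α.re) (n : ℕ) {z : ℝ} (hz : 0 ≤ z) :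
    ‖expMoment α n z‖ ≤ ‖α‖ ^ n := by
  have := intervalIntegral.norm_integral_le_of_norm_le_const (a := 0) (b := 1) (C := ‖α‖ ^ n)
    (f := fun t : ℝ => (-((t : ℂ) * α)) ^ n * Complex.exp (-((t : ℂ) * z * α))) ?_
  · simpa using! this
  intro t ht
  rw [uIoc_of_le zero_le_one] at ht
  have ht1 : |t| ≤ 1 := by rw [abs_of_pos ht.1]; exact ht.2
  have h1 : ‖Complex.exp (-((t : ℂ) * z * α))‖ ≤ 1 := by
    rw [Complex.norm_exp, Real.exp_le_one_iff, ← Complex.ofReal_mul, Complex.neg_re,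
      Complex.re_ofReal_mul, neg_nonpos]
    exact mul_nonneg (mul_nonneg ht.1.le hz) hα
  rw [norm_mul, norm_pow, norm_neg, norm_mul, Complex.norm_real, Real.norm_eq_abs]
  calc (|t| * ‖α‖) ^ n * ‖Complex.exp (-((t : ℂ) * z * α))‖ ≤ (1 * ‖α‖) ^ n * 1 := by gcongr
    _ = _ := by simp

/-- The moment is the entire quotient `(1 - e^{-zα})/(zα)`. Writing it as an integral makes the
division by `k` harmless at `k = 0`. -/
theorem mul_expMoment_zero (α : ℂ) (z : ℝ) :
    (z : ℂ) * α * expMoment α 0 z = 1 - Complex.exp (-((z : ℂ) * α)) := by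
  by_cases h : (z : ℂ) * α = 0
  · simp [h]
  have h' : -((z : ℂ) * α) ≠ 0 := neg_ne_zero.2 h
  have e : expMoment α 0 z = ∫ t in (0 : ℝ)..1, Complex.exp (-((z : ℂ) * α) * t) := by
    unfold expMoment
    congr 1; ext t
    rw [pow_zero, one_mul]
    congr 1; ring
  rw [e, integral_exp_mul_complex h', div_neg, mul_neg, mul_div_cancel₀ _ h]
  simp

/-- The `n`-th derivative of `z ↦ z⁻¹ ∑ᵢ λᵢ² e^{-z(λᵢ-λⱼ)}`. -/
def volterraSymbol (j : Fin 3) (n : ℕ) (z : ℝ) : ℂ :=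
  ∑ i, -(lam i ^ 2 * (lam i - lam j)) * expMoment (lam i - lam j) n z

theorem hasDerivAt_volterraSymbol (j : Fin 3) (n : ℕ) (z : ℝ) :
    HasDerivAt (volterraSymbol j n) (volterraSymbol j (n + 1) z) z :=
  HasDerivAt.fun_sum fun i _ => (hasDerivAt_expMoment (lam i - lam j) n z).const_mul _

theorem continuous_volterraSymbol (j : Fin 3) (n : ℕ) : Continuous (volterraSymbol j n) :=
  continuous_iff_continuousAt.2 fun z => (hasDerivAt_volterraSymbol j n z).continuousAt

theorem norm_volterraSymbol_le {j : Fin 3} (hj : j ≠ 2) (n : ℕ) {z : ℝ} (hz : 0 ≤ z) :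
    ‖volterraSymbol j n z‖ ≤ 3 * 2 ^ (n + 1) := by
  have : ∀ i ∈ Finset.univ, ‖-(lam i ^ 2 * (lam i - lam j)) * expMoment (lam i - lam j) n z‖
      ≤ (2 : ℝ) ^ (n + 1) := by
    intro i _
    rw [norm_mul, norm_neg, norm_mul, norm_pow, norm_lam, one_pow, one_mul, pow_succ']
    have h1 := norm_expMoment_le (lam_sub_re_nonneg i hj) n hz
    have h2 := norm_lam_sub_le i j
    calc ‖lam i - lam j‖ * ‖expMoment (lam i - lam j) n z‖ ≤ 2 * ‖lam i - lam j‖ ^ n := by gcongr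
      _ ≤ 2 * 2 ^ n := by gcongr
  refine (norm_sum_le_of_le _ this).trans ?_
  simp

/-- Each summand contributes its exponential minus the constant `λᵢ²`, and these constants sum to
zero. -/
theorem mul_volterraSymbol_zero (j : Fin 3) (z : ℝ) :
    (z : ℂ) * volterraSymbol j 0 z
      = ∑ i, lam i ^ 2 * Complex.exp (-((z : ℂ) * (lam i - lam j))) := by
  have h : ∀ i, (z : ℂ) * (-(lam i ^ 2 * (lam i - lam j)) * expMoment (lam i - lam j) 0 z)
      = lam i ^ 2 * Complex.exp (-((z : ℂ) * (lam i - lam j))) - lam i ^ 2 := by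
    intro i
    linear_combination (-lam i ^ 2) * mul_expMoment_zero (lam i - lam j) z
  rw [volterraSymbol, Finset.mul_sum, Finset.sum_congr rfl fun i _ => h i,
    Finset.sum_sub_distrib, sum_lam_sq, sub_zero]

/-- The value is `∑ λᵢ² (λⱼ - λᵢ)`. Its independence of `j` is the source of the explicit values of
`r₁` and `r₂` at `0`. -/
theorem volterraSymbol_zero_zero (j : Fin 3) : volterraSymbol j 0 0 = -3 := by
  have h : ∀ i, -(lam i ^ 2 * (lam i - lam j)) * expMoment (lam i - lam j) 0 0
      = lam j * lam i ^ 2 - lam i ^ 3 := by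
    intro i
    simp [expMoment]; ring
  rw [volterraSymbol, Finset.sum_congr rfl fun i _ => h i, Finset.sum_sub_distrib,
    ← Finset.mul_sum, sum_lam_sq, sum_lam_cube]
  ring

end Kernel

/-! ### Integral operators with bounded continuous kernels. -/

section IntegralOperator

/-- Bounded operators on a real normed space. -/
abbrev BoundedOperator (E : Type*) [NormedAddCommGroup E] [NormedSpace ℝ E] := E →L[ℝ] E

/-- Bounded bilinear maps of real normed spaces. -/
abbrev BoundedBilinear (E F G : Type*) [NormedAddCommGroup E] [NormedSpace ℝ E]
    [NormedAddCommGroup F] [NormedSpace ℝ F] [NormedAddCommGroup G] [NormedSpace ℝ G] :=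
  E →L[ℝ] F →L[ℝ] G

variable (μ : Measure ℝ) [IsFiniteMeasure μ]

variable {μ} in
theorem integrable_bcf (f : ℝ →ᵇ ℂ) : Integrable (fun y => f y) μ := f.integrable μ

theorem norm_integral_bcf_mul_le (m φ : ℝ →ᵇ ℂ) :
    ‖∫ y, m y * φ y ∂μ‖ ≤ μ.real univ * ‖m‖ * ‖φ‖ := by
  refine (norm_integral_le_of_norm_le_const (C := ‖m‖ * ‖φ‖)
    (Eventually.of_forall fun y => ?_)).trans (le_of_eq (by ring))
  rw [norm_mul]
  exact mul_le_mul (m.norm_coe_le_norm y) (φ.norm_coe_le_norm y) (norm_nonneg _) (norm_nonneg _)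

/-- The bilinear pairing `(m, φ) ↦ ∫ m φ dμ`. -/
def integralPairing : BoundedBilinear (ℝ →ᵇ ℂ) (ℝ →ᵇ ℂ) ℂ :=
  LinearMap.mkContinuous₂
    (LinearMap.mk₂ ℝ (fun m φ : ℝ →ᵇ ℂ => ∫ y, m y * φ y ∂μ)
      (fun m m' φ => by
        exact (integral_congr_ae (Eventually.of_forall fun y => by simp [add_mul])).trans
          (integral_add (integrable_bcf (m * φ)) (integrable_bcf (m' * φ))))
      (fun c m φ => by
        rw [← integral_smul]
        exact integral_congr_ae (Eventually.of_forall fun y => by simp [mul_assoc]))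
      (fun m φ φ' => by
        exact (integral_congr_ae (Eventually.of_forall fun y => by simp [mul_add])).trans
          (integral_add (integrable_bcf (m * φ)) (integrable_bcf (m * φ'))))
      (fun c m φ => by
        rw [← integral_smul]
        exact integral_congr_ae (Eventually.of_forall fun y => by simp [mul_left_comm])))
    (μ.real univ) (fun m φ => norm_integral_bcf_mul_le μ m φ)

theorem integralPairing_apply (m φ : ℝ →ᵇ ℂ) : integralPairing μ m φ = ∫ y, m y * φ y ∂μ := rfl

/-- The section `y ↦ N (x, y)` of a bounded continuous kernel. -/
def kernelSection (N : ℝ × ℝ →ᵇ ℂ) (x : ℝ) : ℝ →ᵇ ℂ :=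
  N.compContinuous ⟨fun y => (x, y), by fun_prop⟩

theorem norm_kernelSection_le (N : ℝ × ℝ →ᵇ ℂ) (x : ℝ) : ‖kernelSection N x‖ ≤ ‖N‖ :=
  (BoundedContinuousFunction.norm_le (norm_nonneg _)).2 fun y => N.norm_coe_le_norm (x, y)

theorem continuous_integral_kernel (N : ℝ × ℝ →ᵇ ℂ) (φ : ℝ →ᵇ ℂ) :
    Continuous fun x => ∫ y, N (x, y) * φ y ∂μ := by
  refine continuous_of_dominated (bound := fun _ => ‖N‖ * ‖φ‖) (fun x => ?_) (fun x => ?_)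
    (integrable_const _) (Eventually.of_forall fun y => by fun_prop)
  · exact (by fun_prop : Continuous fun y => N (x, y) * φ y).aestronglyMeasurable
  · refine Eventually.of_forall fun y => ?_
    rw [norm_mul]
    exact mul_le_mul (N.norm_coe_le_norm _) (φ.norm_coe_le_norm y) (norm_nonneg _) (norm_nonneg _)

theorem norm_integral_kernel_le (N : ℝ × ℝ →ᵇ ℂ) (φ : ℝ →ᵇ ℂ) (x : ℝ) :
    ‖∫ y, N (x, y) * φ y ∂μ‖ ≤ μ.real univ * ‖N‖ * ‖φ‖ := by
  refine (norm_integral_bcf_mul_le μ (kernelSection N x) φ).trans ?_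
  have := norm_kernelSection_le N x
  gcongr

/-- The integral operator `φ ↦ ∫ N (·, y) φ y dμ(y)`, as a bilinear map. -/
def integralOperator : BoundedBilinear (ℝ × ℝ →ᵇ ℂ) (ℝ →ᵇ ℂ) (ℝ →ᵇ ℂ) :=
  LinearMap.mkContinuous₂
    (LinearMap.mk₂ ℝ (fun (N : ℝ × ℝ →ᵇ ℂ) (φ : ℝ →ᵇ ℂ) =>
        (BoundedContinuousFunction.ofNormedAddCommGroup (fun x => ∫ y, N (x, y) * φ y ∂μ)
          (continuous_integral_kernel μ N φ) _ (norm_integral_kernel_le μ N φ) : ℝ →ᵇ ℂ))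
      (fun m m' φ => by
        ext x
        exact congrFun (congrArg DFunLike.coe
          ((integralPairing μ).map_add (kernelSection m x) (kernelSection m' x))) φ)
      (fun c m φ => by
        ext x
        exact congrFun (congrArg DFunLike.coe
          ((integralPairing μ).map_smul c (kernelSection m x))) φ)
      (fun m φ φ' => by
        ext x
        exact (integralPairing μ (kernelSection m x)).map_add φ φ')
      (fun c m φ => by
        ext x
        exact (integralPairing μ (kernelSection m x)).map_smul c φ))
    (μ.real univ) (fun N φ => (BoundedContinuousFunction.norm_le (by positivity)).2
      fun x => norm_integral_kernel_le μ N φ x)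

theorem integralOperator_apply (N : ℝ × ℝ →ᵇ ℂ) (φ : ℝ →ᵇ ℂ) (x : ℝ) :
    integralOperator μ N φ x = ∫ y, N (x, y) * φ y ∂μ := rfl

/-- Schur's row test. Unlike the bound by the supremum of the kernel, it sees the triangular
Volterra structure and can yield a contraction. -/
theorem norm_integralOperator_le (N : ℝ × ℝ →ᵇ ℂ) {M : ℝ}
    (hM : ∀ x, ∫ y, ‖N (x, y)‖ ∂μ ≤ M) : ‖integralOperator μ N‖ ≤ M := by
  have hM0 : 0 ≤ M := (integral_nonneg fun y => norm_nonneg _).trans (hM 0)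
  refine ContinuousLinearMap.opNorm_le_bound _ hM0 fun φ => ?_
  refine (BoundedContinuousFunction.norm_le (by positivity)).2 fun x => ?_
  rw [integralOperator_apply]
  refine (norm_integral_le_of_norm_le (g := fun y => ‖N (x, y)‖ * ‖φ‖)
    (((kernelSection N x).integrable μ).norm.mul_const _) (Eventually.of_forall fun y => ?_)).trans ?_
  · rw [norm_mul]
    exact mul_le_mul_of_nonneg_left (φ.norm_coe_le_norm y) (norm_nonneg _)
  · rw [integral_mul_const]
    exact mul_le_mul_of_nonneg_right (hM x) (norm_nonneg _)

/-- The finite measure `dy / (1 + y²)`. -/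
def cauchyWeight : Measure ℝ :=
  volume.withDensity fun y => ENNReal.ofReal (1 + y ^ 2)⁻¹

instance : IsFiniteMeasure cauchyWeight :=
  isFiniteMeasure_withDensity_ofReal integrable_inv_one_add_sq.2

theorem integral_cauchyWeight {E : Type*} [NormedAddCommGroup E] [NormedSpace ℝ E] (f : ℝ → E) :
    ∫ y, f y ∂cauchyWeight = ∫ y, (1 + y ^ 2)⁻¹ • f y := by
  have h : (fun y : ℝ => ENNReal.ofReal (1 + y ^ 2)⁻¹)
      = fun y : ℝ => ((Real.toNNReal (1 + y ^ 2)⁻¹ : NNReal) : ENNReal) := rfl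
  rw [cauchyWeight, h, integral_withDensity_eq_integral_smul (by fun_prop)]
  refine integral_congr_ae (Eventually.of_forall fun y => ?_)
  simp only [NNReal.smul_def]
  rw [Real.coe_toNNReal _ (by positivity)]

end IntegralOperator

/-! ### Weights that share the decay of the potential between both variables. -/

section Weights

variable (u : 𝓢(ℝ, ℝ)) (l : ℝ)

/-- A positive, continuous and rapidly decreasing function whose square dominates `|u|`. -/
def rho (x : ℝ) : ℝ := Real.sqrt (|u x| + Real.exp (-|x|))

theorem rho_pos (x : ℝ) : 0 < rho u x :=
  Real.sqrt_pos.2 (add_pos_of_nonneg_of_pos (abs_nonneg _) (Real.exp_pos _))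

theorem continuous_rho : Continuous (rho u) := by
  have := u.continuous
  unfold rho
  fun_prop

theorem abs_le_rho_sq (x : ℝ) : |u x| ≤ rho u x ^ 2 := by
  rw [rho, Real.sq_sqrt (by positivity)]
  linarith [Real.exp_pos (-|x|)]

theorem schwartz_decay {E : Type*} [NormedAddCommGroup E] [NormedSpace ℝ E] (f : 𝓢(ℝ, E)) (n : ℕ) :
    ∃ C, ∀ x, (1 + |x|) ^ n * ‖f x‖ ≤ C := by
  refine ⟨2 ^ n * ((Finset.Iic (n, 0)).sup fun m => SchwartzMap.seminorm ℝ m.1 m.2) f,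
    fun x => ?_⟩
  have := SchwartzMap.one_add_le_sup_seminorm_apply (𝕜 := ℝ) (m := (n, 0)) le_rfl le_rfl f x
  simpa using! this

theorem rho_decay (n : ℕ) : ∃ C, ∀ x, (1 + |x|) ^ n * rho u x ≤ C := by
  obtain ⟨C, hC⟩ := schwartz_decay u (2 * n)
  -- After squaring, `C` controls the `|u|` part, and the factorial term comes from `t^{2n} ≤ (2n)!
  -- e^t` with `t = 1 + |x|`.
  refine ⟨Real.sqrt (C + (2 * n).factorial * Real.exp 1), fun x => ?_⟩
  refine Real.le_sqrt_of_sq_le ?_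
  rw [mul_pow, rho, Real.sq_sqrt (by positivity), ← pow_mul, mul_comm n 2, mul_add]
  refine add_le_add (hC x) ?_
  have h1 := Real.pow_div_factorial_le_exp (1 + |x|) (by positivity) (2 * n)
  rw [div_le_iff₀ (by positivity)] at h1
  calc (1 + |x|) ^ (2 * n) * Real.exp (-|x|)
      ≤ (Real.exp (1 + |x|) * (2 * n).factorial) * Real.exp (-|x|) := by gcongr
    _ = (2 * n).factorial * (Real.exp (1 + |x|) * Real.exp (-|x|)) := by ring
    _ = _ := by rw [← Real.exp_add]; ring_nf

/-- The decreasing weight `e^{-l arctan x}`. -/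
def arctanWeight (x : ℝ) : ℝ := Real.exp (-(l * Real.arctan x))

theorem arctanWeight_pos (x : ℝ) : 0 < arctanWeight l x := Real.exp_pos _

theorem continuous_arctanWeight : Continuous (arctanWeight l) := by
  unfold arctanWeight
  fun_prop

theorem abs_mul_arctan_le (x : ℝ) : |l * Real.arctan x| ≤ |l| * Real.pi := by
  rw [abs_mul]
  gcongr
  rw [abs_le]
  constructor
  · linarith [Real.neg_pi_div_two_lt_arctan x, Real.pi_pos]
  · linarith [Real.arctan_lt_pi_div_two x, Real.pi_pos]

theorem arctanWeight_le (x : ℝ) : arctanWeight l x ≤ Real.exp (|l| * Real.pi) :=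
  Real.exp_le_exp.2 ((neg_le_abs _).trans (abs_mul_arctan_le l x))

theorem inv_arctanWeight_le (x : ℝ) : (arctanWeight l x)⁻¹ ≤ Real.exp (|l| * Real.pi) := by
  rw [arctanWeight, ← Real.exp_neg, neg_neg]
  exact Real.exp_le_exp.2 ((le_abs_self _).trans (abs_mul_arctan_le l x))

/-- `∫_x^∞ e^{-l arctan y} dy / (1 + y²) ≤ e^{-l arctan x} / l`. -/
theorem integral_Ioi_arctanWeight_le {l : ℝ} (hl : 0 < l) (x : ℝ) :
    ∫ y in Ioi x, (1 + y ^ 2)⁻¹ * arctanWeight l y ≤ arctanWeight l x / l := by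
  have hd : ∀ y ∈ Ici x, HasDerivAt (fun y => -(arctanWeight l y / l))
      ((1 + y ^ 2)⁻¹ * arctanWeight l y) y := by
    intro y _
    have h := (((((Real.hasDerivAt_arctan y).const_mul l).neg).exp).div_const l).neg
    convert! h using 1
    simp only [arctanWeight, Pi.neg_apply]
    field_simp
  have hint : IntegrableOn (fun y => (1 + y ^ 2)⁻¹ * arctanWeight l y) (Ioi x) := by
    refine (integrable_inv_one_add_sq.mul_bdd (c := Real.exp (|l| * Real.pi))
      (continuous_arctanWeight l).aestronglyMeasurable
      (Eventually.of_forall fun y => ?_)).integrableOn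
    rw [Real.norm_of_nonneg (arctanWeight_pos l y).le]
    exact arctanWeight_le l y
  have ht : Tendsto (fun y => -(arctanWeight l y / l)) atTop
      (𝓝 (-(Real.exp (-(l * (Real.pi / 2))) / l))) := by
    have h1 : Tendsto Real.arctan atTop (𝓝 (Real.pi / 2)) :=
      Real.tendsto_arctan_atTop.mono_right nhdsWithin_le_nhds
    exact ((Real.continuous_exp.tendsto _).comp ((h1.const_mul l).neg)).div_const l |>.neg
  rw [integral_Ioi_of_hasDerivAt_of_tendsto' hd hint ht]
  have : 0 ≤ Real.exp (-(l * (Real.pi / 2))) / l := by positivity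
  linarith

/-- The left weight of the symmetrized kernel. -/
def leftWeight (x : ℝ) : ℝ := rho u x / arctanWeight l x

/-- The right weight of the symmetrized kernel. -/
def rightWeight (y : ℝ) : ℝ := u y / rho u y * arctanWeight l y * (1 + y ^ 2)

theorem leftWeight_pos (x : ℝ) : 0 < leftWeight u l x :=
  div_pos (rho_pos u x) (arctanWeight_pos l x)

theorem continuous_leftWeight : Continuous (leftWeight u l) :=
  (continuous_rho u).div (continuous_arctanWeight l) fun x => (arctanWeight_pos l x).ne'

theorem continuous_rightWeight : Continuous (rightWeight u l) :=
  ((u.continuous.div (continuous_rho u) fun x => (rho_pos u x).ne').mul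
    (continuous_arctanWeight l)).mul (by fun_prop)

/-- Conjugation by the left weight turns `u(y) dy` into the right weight times `dy/(1+y²)`; all
other factors cancel. -/
theorem rightWeight_mul_leftWeight (y : ℝ) :
    (1 + y ^ 2)⁻¹ * (rightWeight u l y * leftWeight u l y) = u y := by
  have h1 := (rho_pos u y).ne'
  have h2 := (arctanWeight_pos l y).ne'
  have h3 : (1 + y ^ 2) ≠ 0 := by positivity
  rw [rightWeight, leftWeight]
  field_simp

theorem abs_div_rho_le (y : ℝ) : |u y / rho u y| ≤ rho u y := by
  rw [abs_div, abs_of_pos (rho_pos u y), div_le_iff₀ (rho_pos u y), ← sq]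
  exact abs_le_rho_sq u y

theorem one_add_sq_le (y : ℝ) : 1 + y ^ 2 ≤ (1 + |y|) ^ 2 := by
  nlinarith [abs_nonneg y, sq_abs y]

theorem leftWeight_decay (n : ℕ) : ∃ C, ∀ x, (1 + |x|) ^ n * |leftWeight u l x| ≤ C := by
  obtain ⟨C, hC⟩ := rho_decay u n
  refine ⟨C * Real.exp (|l| * Real.pi), fun x => ?_⟩
  rw [abs_of_pos (leftWeight_pos u l x), leftWeight, div_eq_mul_inv, ← mul_assoc]
  have h0 : 0 ≤ C := (mul_nonneg (by positivity) (rho_pos u x).le).trans (hC x)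
  have := inv_arctanWeight_le l x
  have := (inv_pos.2 (arctanWeight_pos l x)).le
  exact mul_le_mul (hC x) (inv_arctanWeight_le l x) this h0

theorem rightWeight_decay (n : ℕ) : ∃ C, ∀ x, (1 + |x|) ^ n * |rightWeight u l x| ≤ C := by
  -- The two extra powers pay for the factor `1 + y²`.
  obtain ⟨C, hC⟩ := rho_decay u (n + 2)
  refine ⟨C * Real.exp (|l| * Real.pi), fun x => ?_⟩
  have hr := (rho_pos u x).le
  have h0 : 0 ≤ C := (mul_nonneg (by positivity) hr).trans (hC x)
  rw [rightWeight, abs_mul, abs_mul, abs_of_pos (arctanWeight_pos l x),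
    abs_of_pos (by positivity : 0 < 1 + x ^ 2)]
  have h1 := abs_div_rho_le u x
  have h2 := one_add_sq_le x
  have h3 := (arctanWeight_pos l x).le
  calc (1 + |x|) ^ n * (|u x / rho u x| * arctanWeight l x * (1 + x ^ 2))
      ≤ (1 + |x|) ^ n * (rho u x * arctanWeight l x * (1 + |x|) ^ 2) := by gcongr
    _ = (1 + |x|) ^ (n + 2) * rho u x * arctanWeight l x := by ring
    _ ≤ _ := mul_le_mul (hC x) (arctanWeight_le l x) h3 h0

end Weights

/-! ### The weighted Volterra kernel: smoothness in the parameter and contraction. -/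

section VolterraKernel

variable (u : 𝓢(ℝ, ℝ)) (l : ℝ)

/-- The positive part of `y - x`. -/
def gap (x y : ℝ) : ℝ := max (y - x) 0

theorem gap_nonneg (x y : ℝ) : 0 ≤ gap x y := le_max_right _ _

theorem gap_of_le {x y : ℝ} (h : x ≤ y) : gap x y = y - x := max_eq_left (sub_nonneg.2 h)

theorem gap_of_ge {x y : ℝ} (h : y ≤ x) : gap x y = 0 := max_eq_right (sub_nonpos.2 h)

theorem gap_le (x y : ℝ) : gap x y ≤ (1 + |x|) * (1 + |y|) := by
  refine max_le ?_ (by positivity)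
  nlinarith [le_abs_self y, neg_abs_le x, abs_nonneg x, abs_nonneg y,
    mul_nonneg (abs_nonneg x) (abs_nonneg y)]

/-- The `n`-th derivative in `k` of the symmetrized Volterra kernel. -/
def volterraKernelFun (j : Fin 3) (n : ℕ) (k : ℝ) (z : ℝ × ℝ) : ℂ :=
  2 * leftWeight u l z.1 * (gap z.1 z.2 : ℂ) ^ (n + 1) *
    volterraSymbol j n (gap z.1 z.2 * max k 0) * rightWeight u l z.2

theorem continuous_volterraKernelFun (j : Fin 3) (n : ℕ) (k : ℝ) :
    Continuous (volterraKernelFun u l j n k) := by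
  have h1 := continuous_leftWeight u l
  have h2 := continuous_rightWeight u l
  have h3 := continuous_volterraSymbol j n
  unfold volterraKernelFun gap
  fun_prop

/-- The factor `(y-x)^{n+1}` is at most `(1+|x|)^{n+1} (1+|y|)^{n+1}`, and each weight absorbs its
share. Replacing `k` by `max k 0` keeps the argument of the symbol nonnegative, so the bound holds
for every real `k`. -/
theorem volterraKernelFun_bound {j : Fin 3} (hj : j ≠ 2) (n : ℕ) :
    ∃ C, ∀ k z, ‖volterraKernelFun u l j n k z‖ ≤ C := by
  obtain ⟨C, hC⟩ := leftWeight_decay u l (n + 1)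
  obtain ⟨D, hD⟩ := rightWeight_decay u l (n + 1)
  refine ⟨2 * C * D * (3 * 2 ^ (n + 1)), fun k z => ?_⟩
  have h1 := hC z.1
  have h2 := hD z.2
  have hC0 : 0 ≤ C := le_trans (by positivity) h1
  have h3 := norm_volterraSymbol_le hj n (mul_nonneg (gap_nonneg z.1 z.2) (le_max_right k 0))
  have h4 := gap_le z.1 z.2
  have h5 := gap_nonneg z.1 z.2
  simp only [volterraKernelFun, norm_mul, norm_pow, Complex.norm_real, Real.norm_eq_abs,
    Complex.norm_ofNat]
  rw [abs_of_nonneg h5]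
  calc 2 * |leftWeight u l z.1| * gap z.1 z.2 ^ (n + 1) *
        ‖volterraSymbol j n (gap z.1 z.2 * max k 0)‖ * |rightWeight u l z.2|
      ≤ 2 * |leftWeight u l z.1| * ((1 + |z.1|) * (1 + |z.2|)) ^ (n + 1) *
        (3 * 2 ^ (n + 1)) * |rightWeight u l z.2| := by gcongr
    _ = 2 * ((1 + |z.1|) ^ (n + 1) * |leftWeight u l z.1|) *
        ((1 + |z.2|) ^ (n + 1) * |rightWeight u l z.2|) * (3 * 2 ^ (n + 1)) := by
        rw [mul_pow]; ring
    _ ≤ _ := by gcongr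

variable {j : Fin 3} (hj : j ≠ 2)

/-- `volterraKernelFun` as a bounded continuous function. -/
def volterraKernel (n : ℕ) (k : ℝ) : ℝ × ℝ →ᵇ ℂ :=
  BoundedContinuousFunction.ofNormedAddCommGroup (volterraKernelFun u l j n k)
    (continuous_volterraKernelFun u l j n k) _
    ((volterraKernelFun_bound u l hj n).choose_spec k)

theorem volterraKernel_apply (n : ℕ) (k : ℝ) (z : ℝ × ℝ) :
    volterraKernel u l hj n k z = volterraKernelFun u l j n k z := rfl

theorem boundedDerivs_volterraKernel (n : ℕ) :
    BoundedDerivs (Ici 0) n (volterraKernel u l hj 0) := by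
  refine boundedDerivs_of_pointwise (convex_Ici 0) (volterraKernel u l hj) (fun n => ?_)
    (fun n z k hk => ?_) n
  · obtain ⟨C, hC⟩ := volterraKernelFun_bound u l hj n
    exact ⟨C, fun k _ => (BoundedContinuousFunction.norm_le
      ((norm_nonneg _).trans (hC 0 0))).2 (hC k)⟩
  · have h1 : HasDerivWithinAt (fun k : ℝ => gap z.1 z.2 * max k 0) (gap z.1 z.2) (Ici 0) k := by
      have : HasDerivWithinAt (fun k : ℝ => gap z.1 z.2 * k) (gap z.1 z.2) (Ici 0) k := by
        simpa using! (hasDerivWithinAt_id k (Ici 0)).const_mul (gap z.1 z.2)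
      exact this.congr (fun t ht => by rw [max_eq_left ht]) (by rw [max_eq_left hk])
    have h2 := (hasDerivAt_volterraSymbol j n (gap z.1 z.2 * max k 0)).scomp_hasDerivWithinAt k h1
    have h3 := (h2.const_mul (2 * leftWeight u l z.1 * (gap z.1 z.2 : ℂ) ^ (n + 1))).mul_const
      (rightWeight u l z.2 : ℂ)
    convert! h3 using 1
    rw [volterraKernel_apply, volterraKernelFun, Complex.real_smul]
    ring

/-- Bielecki's device: a Volterra operator becomes a contraction in a suitably weighted norm,
without any smallness of `u`. The same exponent serves all `j` and `k`. -/
theorem exists_norm_integralOperator_le : ∃ l : ℝ, ∀ (j : Fin 3) (hj : j ≠ 2) (k : ℝ),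
    ‖integralOperator cauchyWeight (volterraKernel u l hj 0 k)‖ ≤ 1 / 2 := by
  obtain ⟨C, hC⟩ := rho_decay u 1
  obtain ⟨D, hD⟩ := rho_decay u 3
  have hC0 : 0 < C := lt_of_lt_of_le (mul_pos (by positivity) (rho_pos u 0)) (hC 0)
  have hD0 : 0 < D := lt_of_lt_of_le (mul_pos (by positivity) (rho_pos u 0)) (hD 0)
  -- The kernel is at most `12 C D w(y)/w(x)` for `y > x`, where `12` is the factor `2` times the
  -- symbol bound `3 · 2`. Integrating `w` gains `1/l`, so `l = 24 C D` produces `1/2`. The power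
  -- `3` of `1 + |y|` in `hD` covers the gap once and `1 + y²` twice.
  refine ⟨24 * C * D, fun j hj k => ?_⟩
  set l := 24 * C * D with hl
  have hl0 : 0 < l := by positivity
  refine norm_integralOperator_le _ _ fun x => ?_
  have hwx := arctanWeight_pos l x
  have hint : Integrable (fun y => (1 + y ^ 2)⁻¹ * arctanWeight l y) := by
    refine integrable_inv_one_add_sq.mul_bdd (c := Real.exp (|l| * Real.pi))
      (continuous_arctanWeight l).aestronglyMeasurable
      (Eventually.of_forall fun y => ?_)
    rw [Real.norm_of_nonneg (arctanWeight_pos l y).le]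
    exact arctanWeight_le l y
  have hb : ∀ y, ‖volterraKernel u l hj 0 k (x, y)‖
      ≤ (Ioi x).indicator (fun y => 12 * C * D * (arctanWeight l y / arctanWeight l x)) y := by
    intro y
    rw [volterraKernel_apply, volterraKernelFun]
    by_cases hy : x < y
    · rw [indicator_of_mem (mem_Ioi.2 hy)]
      have h3 := norm_volterraSymbol_le hj 0 (mul_nonneg (gap_nonneg x y) (le_max_right k 0))
      have h4 := gap_le x y
      have h5 := gap_nonneg x y
      have h6 := abs_div_rho_le u y
      have h7 := one_add_sq_le y
      have hwy := (arctanWeight_pos l y).le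
      have hr := (rho_pos u y).le
      have hrx := (rho_pos u x).le
      have h8 := hC x
      have h9 := hD y
      simp only [norm_mul, norm_pow, Complex.norm_real, Real.norm_eq_abs, Complex.norm_ofNat]
      rw [abs_of_nonneg h5, rightWeight, abs_mul, abs_mul, abs_of_pos (arctanWeight_pos l y),
        abs_of_pos (by positivity : 0 < 1 + y ^ 2), abs_of_pos (leftWeight_pos u l x), leftWeight]
      calc 2 * (rho u x / arctanWeight l x) * gap x y ^ (0 + 1) *
            ‖volterraSymbol j 0 (gap x y * max k 0)‖ *
            (|u y / rho u y| * arctanWeight l y * (1 + y ^ 2))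
          ≤ 2 * (rho u x / arctanWeight l x) * ((1 + |x|) * (1 + |y|)) ^ (0 + 1) *
            (3 * 2 ^ (0 + 1)) * (rho u y * arctanWeight l y * (1 + |y|) ^ 2) := by gcongr
        _ = 12 * ((1 + |x|) ^ 1 * rho u x) * ((1 + |y|) ^ 3 * rho u y) *
            (arctanWeight l y / arctanWeight l x) := by ring
        _ ≤ _ := by gcongr
    · rw [indicator_of_notMem (by simpa using hy), gap_of_ge (not_lt.1 hy)]
      simp
  rw [integral_cauchyWeight]
  calc ∫ y, (1 + y ^ 2)⁻¹ • ‖volterraKernel u l hj 0 k (x, y)‖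
      ≤ ∫ y, (Ioi x).indicator (fun y => 12 * C * D / arctanWeight l x *
          ((1 + y ^ 2)⁻¹ * arctanWeight l y)) y := by
        refine integral_mono_of_nonneg (Eventually.of_forall fun y => by positivity)
          ((hint.const_mul _).indicator measurableSet_Ioi) (Eventually.of_forall fun y => ?_)
        have := hb y
        simp only [smul_eq_mul]
        by_cases hy : y ∈ Ioi x
        · rw [indicator_of_mem hy] at this ⊢
          calc _ ≤ (1 + y ^ 2)⁻¹ * (12 * C * D * (arctanWeight l y / arctanWeight l x)) := by
                gcongr
            _ = _ := by ring
        · rw [indicator_of_notMem hy] at this ⊢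
          exact mul_nonpos_of_nonneg_of_nonpos (by positivity) this
    _ = 12 * C * D / arctanWeight l x * ∫ y in Ioi x, (1 + y ^ 2)⁻¹ * arctanWeight l y := by
        rw [integral_indicator measurableSet_Ioi, integral_const_mul]
    _ ≤ 12 * C * D / arctanWeight l x * (arctanWeight l x / l) := by
        have := integral_Ioi_arctanWeight_le hl0 x
        gcongr
    _ = 1 / 2 := by
        rw [div_mul_div_cancel₀ hwx.ne', hl, div_eq_div_iff (by positivity) two_ne_zero]; ring

end VolterraKernel

/-! ### The scalar density and the scattering integrals, smooth up to `k = 0`. -/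

section VolterraSolution

variable (u : 𝓢(ℝ, ℝ)) {j : Fin 3} (hj : j ≠ 2)

/-- The exponent for which the weighted Volterra operators are contractions. -/
def weightExponent : ℝ := (exists_norm_integralOperator_le u).choose

/-- The left weight as a bounded continuous function. -/
def leftWeightBCF : ℝ →ᵇ ℂ :=
  BoundedContinuousFunction.ofNormedAddCommGroup
    (fun x => (leftWeight u (weightExponent u) x : ℂ))
    (Complex.continuous_ofReal.comp (continuous_leftWeight u _))
    (leftWeight_decay u (weightExponent u) 0).choose (fun x => by
      simpa using (leftWeight_decay u (weightExponent u) 0).choose_spec x)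

theorem leftWeightBCF_apply (x : ℝ) :
    leftWeightBCF u x = (leftWeight u (weightExponent u) x : ℂ) := rfl

theorem leftWeightBCF_ne_zero (x : ℝ) : leftWeightBCF u x ≠ 0 :=
  Complex.ofReal_ne_zero.2 (leftWeight_pos u _ x).ne'

/-- The weighted Volterra operator. -/
def volterraOperator (k : ℝ) : BoundedOperator (ℝ →ᵇ ℂ) :=
  integralOperator cauchyWeight (volterraKernel u (weightExponent u) hj 0 k)

theorem norm_volterraOperator_le (k : ℝ) : ‖volterraOperator u hj k‖ ≤ 1 / 2 :=
  (exists_norm_integralOperator_le u).choose_spec j hj k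

theorem isUnit_one_sub_volterraOperator (k : ℝ) : IsUnit (1 - volterraOperator u hj k) :=
  have h : ‖volterraOperator u hj k‖ < 1 :=
    (norm_volterraOperator_le u hj k).trans_lt (by norm_num)
  isUnit_one_sub_of_norm_lt_one h

/-- The resolvent of the weighted Volterra operator at `1`. -/
def volterraResolvent (k : ℝ) : BoundedOperator (ℝ →ᵇ ℂ) :=
  Ring.inverse (1 - volterraOperator u hj k)

/-- From `R = 1 + T R` and `‖T‖ ≤ 1/2`. Uniformity in `k` is what bounds all derivatives of the
resolvent. -/
theorem norm_volterraResolvent_le (k : ℝ) : ‖volterraResolvent u hj k‖ ≤ 2 := by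
  have h1 : (1 - volterraOperator u hj k) * volterraResolvent u hj k = 1 :=
    Ring.mul_inverse_cancel _ (isUnit_one_sub_volterraOperator u hj k)
  have h2 : volterraResolvent u hj k = 1 + volterraOperator u hj k * volterraResolvent u hj k := by
    rw [sub_mul, one_mul] at h1
    exact eq_add_of_sub_eq h1
  have h3 : ‖volterraResolvent u hj k‖ ≤ 1 + 1 / 2 * ‖volterraResolvent u hj k‖ := by
    calc ‖volterraResolvent u hj k‖
        = ‖1 + volterraOperator u hj k * volterraResolvent u hj k‖ := by rw [← h2]
      _ ≤ ‖(1 : BoundedOperator (ℝ →ᵇ ℂ))‖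
          + ‖volterraOperator u hj k * volterraResolvent u hj k‖ := norm_add_le _ _
      _ ≤ _ := by
        refine add_le_add ContinuousLinearMap.norm_id_le ((norm_mul_le _ _).trans ?_)
        exact mul_le_mul_of_nonneg_right (norm_volterraOperator_le u hj k) (norm_nonneg _)
  linarith

theorem boundedDerivs_volterraResolvent (n : ℕ) :
    BoundedDerivs (Ici 0) n (volterraResolvent u hj) := by
  have h1 : BoundedDerivs (Ici 0) (n + 1) (fun k => 1 - volterraOperator u hj k) := by
    have h2 : BoundedDerivs (Ici 0) (n + 1) (volterraOperator u hj) :=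
      (boundedDerivs_volterraKernel u (weightExponent u) hj (n + 1)).clm
        (integralOperator cauchyWeight)
    exact ((boundedDerivs_const 1).add h2.neg).congr fun k _ => sub_eq_add_neg _ _
  obtain ⟨-, f', hf', H⟩ := h1
  exact boundedDerivs_ringInverse hf' H (fun k _ => isUnit_one_sub_volterraOperator u hj k)
    ⟨2, fun k _ => (norm_volterraResolvent_le u hj k :)⟩

/-- The weighted solution of the scalar Volterra equation. -/
def weightedSolution (k : ℝ) : ℝ →ᵇ ℂ :=
  volterraResolvent u hj k (lam j ^ 2 • leftWeightBCF u)

theorem boundedDerivs_weightedSolution (n : ℕ) :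
    BoundedDerivs (Ici 0) n (weightedSolution u hj) :=
  (boundedDerivs_volterraResolvent u hj n).clm
    (ContinuousLinearMap.apply ℝ (ℝ →ᵇ ℂ) (lam j ^ 2 • leftWeightBCF u))

theorem sub_volterraOperator_weightedSolution (k : ℝ) :
    weightedSolution u hj k - volterraOperator u hj k (weightedSolution u hj k)
      = lam j ^ 2 • leftWeightBCF u := by
  have h := Ring.mul_inverse_cancel _ (isUnit_one_sub_volterraOperator u hj k)
  exact congrArg (fun A : BoundedOperator (ℝ →ᵇ ℂ) => A (lam j ^ 2 • leftWeightBCF u)) h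

theorem eq_weightedSolution {k : ℝ} {φ : ℝ →ᵇ ℂ}
    (h : φ - volterraOperator u hj k φ = lam j ^ 2 • leftWeightBCF u) :
    φ = weightedSolution u hj k := by
  have h1 := Ring.inverse_mul_cancel _ (isUnit_one_sub_volterraOperator u hj k)
  have h2 := congrArg (fun A : BoundedOperator (ℝ →ᵇ ℂ) => A φ) h1
  rw [weightedSolution, ← h]
  exact h2.symm

/-- `F` solves the scalar Volterra equation satisfied by `∑ᵢ λᵢ² vᵢ`, for `v` the `j`-th column
of the Jost function. -/
def IsVolterraSolution (j : Fin 3) (k : ℝ) (F : ℝ → ℂ) : Prop :=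
  ∀ x, F x = lam j ^ 2 +
    2 * ∫ y, (gap x y : ℂ) * volterraSymbol j 0 (gap x y * k) * ((u y : ℂ) * F y)

theorem volterraOperator_apply {k : ℝ} (hk : 0 ≤ k) (φ : ℝ →ᵇ ℂ) (x : ℝ) :
    volterraOperator u hj k φ x = leftWeightBCF u x *
      (2 * ∫ y, (gap x y : ℂ) * volterraSymbol j 0 (gap x y * k) *
        ((u y : ℂ) * (φ y / leftWeightBCF u y))) := by
  rw [volterraOperator, integralOperator_apply, integral_cauchyWeight, ← integral_const_mul,
    ← integral_const_mul]
  refine integral_congr_ae (Eventually.of_forall fun y => ?_)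
  have h0 := leftWeightBCF_ne_zero u y
  have h1 := congrArg (fun t : ℝ => (t : ℂ)) (rightWeight_mul_leftWeight u (weightExponent u) y)
  simp only [Complex.ofReal_mul] at h1
  rw [← leftWeightBCF_apply] at h1
  simp only [volterraKernel_apply, volterraKernelFun, Complex.real_smul, max_eq_left hk]
  rw [← h1, ← leftWeightBCF_apply, zero_add, pow_one]
  field_simp

theorem isVolterraSolution_iff {k : ℝ} (hk : 0 ≤ k) (φ : ℝ →ᵇ ℂ) :
    φ - volterraOperator u hj k φ = lam j ^ 2 • leftWeightBCF u ↔
      IsVolterraSolution u j k fun x => φ x / leftWeightBCF u x := by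
  rw [BoundedContinuousFunction.ext_iff]
  refine forall_congr' fun x => ?_
  have h0 := leftWeightBCF_ne_zero u x
  simp only [BoundedContinuousFunction.coe_sub, Pi.sub_apply,
    BoundedContinuousFunction.coe_smul, smul_eq_mul]
  rw [volterraOperator_apply u hj hk, div_eq_iff h0, sub_eq_iff_eq_add,
    add_mul, mul_comm (leftWeightBCF u x) (2 * _)]

/-- The solution of the scalar Volterra equation. -/
def jostDensity (k x : ℝ) : ℂ := weightedSolution u hj k x / leftWeightBCF u x

theorem isVolterraSolution_jostDensity {k : ℝ} (hk : 0 ≤ k) :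
    IsVolterraSolution u j k (jostDensity u hj k) :=
  (isVolterraSolution_iff u hj hk _).1 (sub_volterraOperator_weightedSolution u hj k)

theorem continuous_jostDensity (k : ℝ) : Continuous (jostDensity u hj k) :=
  (weightedSolution u hj k).continuous.div (leftWeightBCF u).continuous (leftWeightBCF_ne_zero u)

/-- A bounded solution times the left weight is a fixed point of the contraction. The construction
of `jostDensity` only bounds its product with the left weight; at `k = 0` the density itself need
not be bounded. -/
theorem eq_jostDensity {k : ℝ} (hk : 0 ≤ k) {F : ℝ → ℂ} (hF : IsVolterraSolution u j k F)
    (hc : Continuous F) {C : ℝ} (hC : ∀ x, ‖F x‖ ≤ C) : F = jostDensity u hj k := by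
  set φ : ℝ →ᵇ ℂ := leftWeightBCF u * BoundedContinuousFunction.ofNormedAddCommGroup F hc C hC
  have h : (fun x => φ x / leftWeightBCF u x) = F := by
    ext x
    exact mul_div_cancel_left₀ _ (leftWeightBCF_ne_zero u x)
  have h1 : φ = weightedSolution u hj k :=
    eq_weightedSolution u hj ((isVolterraSolution_iff u hj hk φ).2 (h ▸ hF))
  rw [← h, h1]
  rfl

/-- A majorant of `u F` that does not depend on `k`. -/
theorem exists_norm_mul_jostDensity_le :
    ∃ C, ∀ k x, 0 ≤ k → ‖(u x : ℂ) * jostDensity u hj k x‖ ≤ C * (1 + x ^ 2)⁻¹ := by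
  obtain ⟨C, hC⟩ := (boundedDerivs_weightedSolution u hj 0).bounded
  obtain ⟨D, hD⟩ := rightWeight_decay u (weightExponent u) 0
  refine ⟨D * C, fun k x hk => ?_⟩
  have h0 := leftWeightBCF_ne_zero u x
  have h1 := congrArg (fun t : ℝ => (t : ℂ)) (rightWeight_mul_leftWeight u (weightExponent u) x)
  simp only [Complex.ofReal_mul] at h1
  rw [← leftWeightBCF_apply] at h1
  have h2 : (u x : ℂ) * jostDensity u hj k x =
      ((1 + x ^ 2 : ℝ)⁻¹ : ℝ) * (rightWeight u (weightExponent u) x * weightedSolution u hj k x) := by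
    rw [← h1, jostDensity]
    field_simp
  have h3 : ‖weightedSolution u hj k x‖ ≤ C :=
    ((weightedSolution u hj k).norm_coe_le_norm x).trans (hC k hk)
  have h4 : |rightWeight u (weightExponent u) x| ≤ D := by simpa using hD x
  have h5 : 0 ≤ D := (abs_nonneg _).trans h4
  rw [h2, norm_mul, norm_mul, Complex.norm_real, Complex.norm_real, Real.norm_eq_abs,
    Real.norm_eq_abs, abs_of_pos (by positivity), mul_comm]
  gcongr

theorem continuous_mul_jostDensity (k : ℝ) :
    Continuous fun x => (u x : ℂ) * jostDensity u hj k x := by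
  have := u.continuous
  have := continuous_jostDensity u hj k
  fun_prop

theorem integrable_mul_jostDensity {k : ℝ} (hk : 0 ≤ k) :
    Integrable fun x => (u x : ℂ) * jostDensity u hj k x := by
  obtain ⟨C, hC⟩ := exists_norm_mul_jostDensity_le u hj
  exact (integrable_inv_one_add_sq.const_mul C).mono'
    (continuous_mul_jostDensity u hj k).aestronglyMeasurable
    (Eventually.of_forall fun x => hC k x hk)

theorem exists_integral_norm_mul_jostDensity_le :
    ∃ C, ∀ k, 0 ≤ k → ∫ x, ‖(u x : ℂ) * jostDensity u hj k x‖ ≤ C := by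
  obtain ⟨C, hC⟩ := exists_norm_mul_jostDensity_le u hj
  exact ⟨_, fun k hk => integral_mono (integrable_mul_jostDensity u hj hk).norm
    (integrable_inv_one_add_sq.const_mul C) fun x => hC k x hk⟩

/-- The integral whose value is `k (s₁ⱼ(k) - δ₁ⱼ)`. -/
def scatteringIntegral (k : ℝ) : ℂ :=
  2 * ∫ x : ℝ, Complex.exp (-((x : ℂ) * k * (lam 0 - lam j))) *
    ((u x : ℂ) * jostDensity u hj k x)

/-- The `n`-th `k`-derivative of the density of the scattering functional. -/
def scatteringKernelFun (n : ℕ) (k y : ℝ) : ℂ :=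
  (-((y : ℂ) * (lam 0 - lam j))) ^ n * Complex.exp (-((y : ℂ) * k * (lam 0 - lam j))) *
    rightWeight u (weightExponent u) y

theorem norm_exp_mul_lam_zero_sub {j : Fin 3} (hj : j ≠ 2) (x k : ℝ) :
    ‖Complex.exp (-((x : ℂ) * k * (lam 0 - lam j)))‖ = 1 := by
  rw [Complex.norm_exp, ← Complex.ofReal_mul, Complex.neg_re, Complex.re_ofReal_mul,
    lam_zero_sub_lam_re hj]
  simp

theorem continuous_scatteringKernelFun (n : ℕ) (k : ℝ) :
    Continuous (scatteringKernelFun u (j := j) n k) := by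
  have := continuous_rightWeight u (weightExponent u)
  unfold scatteringKernelFun
  fun_prop

theorem scatteringKernelFun_bound {j : Fin 3} (hj : j ≠ 2) (n : ℕ) :
    ∃ C, ∀ k y, ‖scatteringKernelFun u (j := j) n k y‖ ≤ C := by
  obtain ⟨D, hD⟩ := rightWeight_decay u (weightExponent u) n
  refine ⟨2 ^ n * D, fun k y => ?_⟩
  rw [scatteringKernelFun, norm_mul, norm_mul, norm_exp_mul_lam_zero_sub hj, norm_pow, norm_neg,
    norm_mul, Complex.norm_real, Complex.norm_real, Real.norm_eq_abs, Real.norm_eq_abs]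
  have h1 := norm_lam_sub_le 0 j
  have h2 : |y| ≤ 1 + |y| := by linarith
  calc (|y| * ‖lam 0 - lam j‖) ^ n * 1 * |rightWeight u (weightExponent u) y|
      ≤ ((1 + |y|) * 2) ^ n * 1 * |rightWeight u (weightExponent u) y| := by gcongr
    _ = 2 ^ n * ((1 + |y|) ^ n * |rightWeight u (weightExponent u) y|) := by
        rw [mul_pow]; ring
    _ ≤ _ := by gcongr; exact hD y

/-- `scatteringKernelFun` as a bounded continuous function. -/
def scatteringKernel (n : ℕ) (k : ℝ) : ℝ →ᵇ ℂ :=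
  BoundedContinuousFunction.ofNormedAddCommGroup (scatteringKernelFun u (j := j) n k)
    (continuous_scatteringKernelFun u n k) _ ((scatteringKernelFun_bound u hj n).choose_spec k)

theorem boundedDerivs_scatteringKernel (n : ℕ) :
    BoundedDerivs (Ici 0) n (scatteringKernel u hj 0) := by
  refine boundedDerivs_of_pointwise (convex_Ici 0) (scatteringKernel u hj) (fun n => ?_)
    (fun n z k hk => ?_) n
  · obtain ⟨C, hC⟩ := scatteringKernelFun_bound u hj n
    exact ⟨C, fun k _ => (BoundedContinuousFunction.norm_le
      ((norm_nonneg _).trans (hC 0 0))).2 (hC k)⟩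
  · have h1 : HasDerivAt (fun k : ℝ => -((z : ℂ) * (k : ℝ) * (lam 0 - lam j)))
        (-((z : ℂ) * (lam 0 - lam j))) k := by
      have := (((Complex.ofRealCLM.hasDerivAt (x := k)).const_mul (z : ℂ)).mul_const
        (lam 0 - lam j)).neg
      simpa using! this
    have h2 := ((h1.cexp.const_mul ((-((z : ℂ) * (lam 0 - lam j))) ^ n)).mul_const
      (rightWeight u (weightExponent u) z : ℂ)).hasDerivWithinAt (s := Ici 0)
    convert! h2 using 1
    change scatteringKernelFun u (n + 1) k z = _
    rw [scatteringKernelFun]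
    ring

/-- All dependence on `k` is moved into two bounded functions, both smooth in `k` for the supremum
norm. Powers of `y` produced by differentiating the exponential are absorbed by the right weight. -/
theorem scatteringIntegral_eq_pairing (k : ℝ) :
    scatteringIntegral u hj k =
      2 * integralPairing cauchyWeight (scatteringKernel u hj 0 k) (weightedSolution u hj k) := by
  rw [scatteringIntegral, integralPairing_apply, integral_cauchyWeight]
  congr 1
  refine integral_congr_ae (Eventually.of_forall fun y => ?_)
  change _ = (1 + y ^ 2)⁻¹ • (scatteringKernelFun u 0 k y * weightedSolution u hj k y)
  have h0 := leftWeightBCF_ne_zero u y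
  have h1 := congrArg (fun t : ℝ => (t : ℂ)) (rightWeight_mul_leftWeight u (weightExponent u) y)
  simp only [Complex.ofReal_mul] at h1
  rw [← leftWeightBCF_apply] at h1
  simp only [scatteringKernelFun, Complex.real_smul, pow_zero, one_mul, ← h1, jostDensity]
  field_simp

theorem boundedDerivs_scatteringIntegral (n : ℕ) :
    BoundedDerivs (Ici 0) n (scatteringIntegral u hj) := by
  have h := (boundedDerivs_scatteringKernel u hj n).bilinear (integralPairing cauchyWeight)
    (boundedDerivs_weightedSolution u hj n)
  exact (h.clm (ContinuousLinearMap.mul ℝ ℂ 2)).congr fun k _ =>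
    scatteringIntegral_eq_pairing u hj k

/-- At `k = 0` the symbol is `-3` for every `j`, so the Volterra equations differ only in the
inhomogeneity `λⱼ²` and their solutions are proportional. -/
theorem scatteringIntegral_zero {j' : Fin 3} (hj' : j' ≠ 2) :
    lam j' ^ 2 * scatteringIntegral u hj 0 = lam j ^ 2 * scatteringIntegral u hj' 0 := by
  have h1 : ∀ x, lam j' ^ 2 * jostDensity u hj 0 x = lam j ^ 2 * jostDensity u hj' 0 x := by
    have h2 : IsVolterraSolution u j' 0 fun x => (lam j' ^ 2 / lam j ^ 2) * jostDensity u hj 0 x := by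
      intro x
      have h3 := isVolterraSolution_jostDensity u hj le_rfl x
      have hlj := lam_ne_zero j
      simp only [mul_zero, volterraSymbol_zero_zero, mul_left_comm _ (lam j' ^ 2 / lam j ^ 2),
        integral_const_mul] at h3 ⊢
      rw [h3]
      have hr : ∀ I : ℂ, lam j' ^ 2 / lam j ^ 2 * (lam j ^ 2 + 2 * I)
          = lam j' ^ 2 + lam j' ^ 2 / lam j ^ 2 * (2 * I) := by
        intro I
        field_simp
      exact hr _
    -- Uniqueness is applied to the weighted function, as `eq_jostDensity` would require a bounded
    -- density.
    set φ : ℝ →ᵇ ℂ := (lam j' ^ 2 / lam j ^ 2) • weightedSolution u hj 0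
    have h4 : (fun x => φ x / leftWeightBCF u x)
        = fun x => (lam j' ^ 2 / lam j ^ 2) * jostDensity u hj 0 x := by
      ext x
      simp only [φ, jostDensity, BoundedContinuousFunction.coe_smul, smul_eq_mul, mul_div_assoc]
    have h5 : φ = weightedSolution u hj' 0 :=
      eq_weightedSolution u hj' ((isVolterraSolution_iff u hj' le_rfl φ).2 (h4 ▸ h2))
    intro x
    have h6 := congrFun h4 x
    simp only [h5] at h6
    change jostDensity u hj' 0 x = _ at h6
    have hlj := lam_ne_zero j
    rw [h6]
    field_simp
  simp only [scatteringIntegral, Complex.ofReal_zero, mul_zero, zero_mul, neg_zero,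
    Complex.exp_zero, one_mul]
  rw [mul_left_comm, mul_left_comm (lam j ^ 2), ← integral_const_mul (lam j' ^ 2),
    ← integral_const_mul (lam j ^ 2)]
  congr 2
  funext x
  linear_combination (u x : ℂ) * h1 x

end VolterraSolution

/-! ### Jost columns recovered from the scalar density. -/

section JostColumns

theorem Q_mulVec (u : ℝ → ℝ) (k : ℂ) (y : ℝ) (w : Fin 3 → ℂ) (i : Fin 3) :
    (Q u k y).mulVec w i = -(2 / k) * ((u y : ℂ) * ∑ m, lam m ^ 2 * w m) := by
  have h : om ^ 4 = om := by linear_combination om * om_cube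
  fin_cases i <;>
  · simp [Q, Matrix.mulVec, dotProduct, Fin.sum_univ_three, ← pow_mul, h]
    ring

theorem Q_transpose_mulVec (u : ℝ → ℝ) (k : ℂ) (y : ℝ) (w : Fin 3 → ℂ) (i : Fin 3) :
    (Q u k y).transpose.mulVec w i = -(2 / k) * (lam i ^ 2 * ((u y : ℂ) * ∑ m, w m)) := by
  have h : om ^ 4 = om := by linear_combination om * om_cube
  fin_cases i <;>
  · simp [Q, Matrix.mulVec, dotProduct, Fin.sum_univ_three, ← pow_mul, h]
    ring

variable {j : Fin 3} {k : ℝ}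

theorem norm_exp_le_one (hj : j ≠ 2) (hk : 0 ≤ k) (i : Fin 3) {x y : ℝ} (h : x ≤ y) :
    ‖Complex.exp (((x - y : ℝ) : ℂ) * k * (lam i - lam j))‖ ≤ 1 := by
  rw [Complex.norm_exp, Real.exp_le_one_iff, ← Complex.ofReal_mul, Complex.re_ofReal_mul]
  exact mul_nonpos_of_nonpos_of_nonneg (mul_nonpos_of_nonpos_of_nonneg (by linarith) hk)
    (lam_sub_re_nonneg i hj)

theorem norm_exp_mul_le (hj : j ≠ 2) (hk : 0 ≤ k) (i : Fin 3) {x y : ℝ} (h : x ≤ y) (c : ℂ) :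
    ‖Complex.exp (((x - y : ℝ) : ℂ) * k * (lam i - lam j)) * c‖ ≤ ‖c‖ := by
  rw [norm_mul]
  exact mul_le_of_le_one_left (norm_nonneg _) (norm_exp_le_one hj hk i h)

theorem integrableOn_exp_mul (hj : j ≠ 2) (hk : 0 ≤ k) (i : Fin 3) (x : ℝ) {g : ℝ → ℂ}
    (hg : Integrable g) :
    IntegrableOn (fun y => Complex.exp (((x - y : ℝ) : ℂ) * k * (lam i - lam j)) * g y) (Ioi x) := by
  refine Integrable.mono' (g := fun y => ‖g y‖) hg.norm.integrableOn ?_ ?_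
  · exact (by fun_prop : Continuous fun y : ℝ => Complex.exp (((x - y : ℝ) : ℂ) * k *
      (lam i - lam j))).aestronglyMeasurable.mul hg.aestronglyMeasurable.restrict
  · filter_upwards [ae_restrict_mem measurableSet_Ioi] with y hy
    exact norm_exp_mul_le hj hk i (mem_Ioi.1 hy).le _

theorem norm_integral_exp_mul_le (hj : j ≠ 2) (hk : 0 ≤ k) (i : Fin 3) (x : ℝ) {g : ℝ → ℂ}
    (hg : Integrable g) :
    ‖∫ y in Ioi x, Complex.exp (((x - y : ℝ) : ℂ) * k * (lam i - lam j)) * g y‖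
      ≤ ∫ y, ‖g y‖ := by
  refine (norm_integral_le_of_norm_le (g := fun y => ‖g y‖) hg.norm.integrableOn ?_).trans
    (setIntegral_le_integral hg.norm (Eventually.of_forall fun y => norm_nonneg _))
  filter_upwards [ae_restrict_mem measurableSet_Ioi] with y hy
  exact norm_exp_mul_le hj hk i (mem_Ioi.1 hy).le _

theorem continuous_integral_exp_mul (hj : j ≠ 2) (hk : 0 ≤ k) (i : Fin 3) {g : ℝ → ℂ}
    (hg : Integrable g) :
    Continuous fun x =>
      ∫ y in Ioi x, Complex.exp (((x - y : ℝ) : ℂ) * k * (lam i - lam j)) * g y := by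
  simp_rw [← integral_indicator measurableSet_Ioi]
  refine continuous_iff_continuousAt.2 fun x₀ => ?_
  refine continuousAt_of_dominated (bound := fun y => ‖g y‖)
    (Eventually.of_forall fun x => ?_) (Eventually.of_forall fun x => ?_) hg.norm ?_
  · refine AEStronglyMeasurable.indicator ?_ measurableSet_Ioi
    exact (by fun_prop : Continuous fun y : ℝ => Complex.exp (((x - y : ℝ) : ℂ) * k *
      (lam i - lam j))).aestronglyMeasurable.mul hg.aestronglyMeasurable
  · refine Eventually.of_forall fun y => ?_
    by_cases hy : y ∈ Ioi x
    · rw [indicator_of_mem hy]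
      exact norm_exp_mul_le hj hk i (mem_Ioi.1 hy).le _
    · rw [indicator_of_notMem hy]
      simp
  -- For fixed `y` the truncated integrand jumps in `x` only at `x = y`, so continuity at `x₀` fails
  -- at most for the single value `y = x₀`.
  · filter_upwards [compl_mem_ae_iff.2 (measure_singleton x₀)] with y hy
    have hy' : y ≠ x₀ := hy
    rcases lt_or_gt_of_ne hy' with h | h
    · refine ContinuousAt.congr (f := fun _ => (0 : ℂ)) continuousAt_const ?_
      filter_upwards [Ioi_mem_nhds h] with x hx
      rw [indicator_of_notMem (by simpa using (mem_Ioi.1 hx).le)]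
    · refine ContinuousAt.congr (f := fun x : ℝ =>
        Complex.exp (((x - y : ℝ) : ℂ) * k * (lam i - lam j)) * g y) (by fun_prop) ?_
      filter_upwards [Iio_mem_nhds h] with x hx
      rw [indicator_of_mem (mem_Ioi.2 (mem_Iio.1 hx))]

/-- The three exponential integrals combine into the scalar Volterra integral. -/
theorem sum_integral_exp_mul (hj : j ≠ 2) (hk : 0 < k) (x : ℝ) {g : ℝ → ℂ} (hg : Integrable g) :
    ∑ i, lam i ^ 2 * ((2 / k) *
        ∫ y in Ioi x, Complex.exp (((x - y : ℝ) : ℂ) * k * (lam i - lam j)) * g y)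
      = 2 * ∫ y, (gap x y : ℂ) * volterraSymbol j 0 (gap x y * k) * g y := by
  have hk0 : (k : ℂ) ≠ 0 := Complex.ofReal_ne_zero.2 hk.ne'
  have h1 : ∀ i, lam i ^ 2 * ((2 / k) *
        ∫ y in Ioi x, Complex.exp (((x - y : ℝ) : ℂ) * k * (lam i - lam j)) * g y)
      = ∫ y in Ioi x, (2 / k) * lam i ^ 2 *
          (Complex.exp (((x - y : ℝ) : ℂ) * k * (lam i - lam j)) * g y) := by
    intro i
    rw [integral_const_mul]
    ring
  rw [Finset.sum_congr rfl fun i _ => h1 i,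
    ← integral_finsetSum _ fun i _ => (integrableOn_exp_mul hj hk.le i x hg).const_mul _,
    ← integral_const_mul, ← integral_indicator measurableSet_Ioi]
  refine integral_congr_ae (Eventually.of_forall fun y => ?_)
  by_cases hy : y ∈ Ioi x
  · have hxy := (mem_Ioi.1 hy).le
    simp only [indicator_of_mem hy, gap_of_le hxy]
    have h2 := mul_volterraSymbol_zero j ((y - x) * k)
    have h3 : ∀ i, Complex.exp (((x - y : ℝ) : ℂ) * k * (lam i - lam j))
        = Complex.exp (-((((y - x) * k : ℝ) : ℂ) * (lam i - lam j))) := by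
      intro i
      congr 1; push_cast; ring
    simp only [h3]
    have h4 : ∑ i, (2 / k : ℂ) * lam i ^ 2 *
          (Complex.exp (-((((y - x) * k : ℝ) : ℂ) * (lam i - lam j))) * g y)
        = (2 / k : ℂ) * g y *
          ∑ i, lam i ^ 2 * Complex.exp (-((((y - x) * k : ℝ) : ℂ) * (lam i - lam j))) := by
      rw [Finset.mul_sum]
      exact Finset.sum_congr rfl fun i _ => by ring
    rw [h4, ← h2]
    push_cast
    field_simp
  · have hxy : y ≤ x := by simpa using hy
    simp [indicator_of_notMem hy, gap_of_ge hxy]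

variable (u : 𝓢(ℝ, ℝ)) (hj : j ≠ 2)

/-- The `j`-th Jost column, reconstructed from the scalar density. -/
def jostVector (k x : ℝ) (i : Fin 3) : ℂ :=
  (1 : Matrix (Fin 3) (Fin 3) ℂ) i j + (2 / k) *
    ∫ y in Ioi x, Complex.exp (((x - y : ℝ) : ℂ) * k * (lam i - lam j)) *
      ((u y : ℂ) * jostDensity u hj k y)

theorem sum_lam_sq_mul_one (j : Fin 3) :
    ∑ i, lam i ^ 2 * (1 : Matrix (Fin 3) (Fin 3) ℂ) i j = lam j ^ 2 := by
  simp [Matrix.one_apply]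

theorem sum_lam_sq_mul_jostVector (hk : 0 < k) (x : ℝ) :
    ∑ i, lam i ^ 2 * jostVector u hj k x i = jostDensity u hj k x := by
  simp only [jostVector, mul_add, Finset.sum_add_distrib, sum_lam_sq_mul_one]
  rw [sum_integral_exp_mul hj hk x (integrable_mul_jostDensity u hj hk.le)]
  exact (isVolterraSolution_jostDensity u hj hk.le x).symm

theorem norm_jostVector_le (hk : 0 < k) (x : ℝ) (i : Fin 3) :
    ‖jostVector u hj k x i‖ ≤ 1 + 2 / k * ∫ y, ‖(u y : ℂ) * jostDensity u hj k y‖ := by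
  refine (norm_add_le _ _).trans (add_le_add ?_ ?_)
  · rw [Matrix.one_apply]
    split_ifs <;> simp
  · rw [norm_mul, norm_div, Complex.norm_real, Complex.norm_ofNat, Real.norm_of_nonneg hk.le]
    exact mul_le_mul_of_nonneg_left
      (norm_integral_exp_mul_le hj hk.le i x (integrable_mul_jostDensity u hj hk.le))
      (by positivity)

theorem jost_integral_eq (k : ℂ) (x : ℝ) (i : Fin 3) (v : ℝ → Fin 3 → ℂ) :
    (1 : Matrix (Fin 3) (Fin 3) ℂ) i j - ∫ y in Ioi x,
        Complex.exp (((x - y : ℝ) : ℂ) * k * (lam i - lam j)) * (Q u k y).mulVec (v y) i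
      = (1 : Matrix (Fin 3) (Fin 3) ℂ) i j + (2 / k) * ∫ y in Ioi x,
        Complex.exp (((x - y : ℝ) : ℂ) * k * (lam i - lam j)) *
          ((u y : ℂ) * ∑ m, lam m ^ 2 * v y m) := by
  simp only [Q_mulVec, mul_left_comm _ (-(2 / k)), integral_const_mul]
  ring

theorem isJostColumn_jostVector (hk : 0 < k) : IsJostColumn u k j (jostVector u hj k) := by
  have hg := integrable_mul_jostDensity u hj hk.le
  refine ⟨continuous_pi fun i => ?_, ⟨1 + 2 / k * ∫ y, ‖(u y : ℂ) * jostDensity u hj k y‖,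
    fun x => (pi_norm_le_iff_of_nonempty _).2 fun i => norm_jostVector_le u hj hk x i⟩,
    fun x i => ?_⟩
  · exact continuous_const.add (continuous_const.mul (continuous_integral_exp_mul hj hk.le i hg))
  · rw [jost_integral_eq]
    simp only [sum_lam_sq_mul_jostVector u hj hk]
    rfl

theorem integrable_schwartz_mul {F : ℝ → ℂ} (hc : Continuous F) {C : ℝ} (hC : ∀ x, ‖F x‖ ≤ C) :
    Integrable fun y => (u y : ℂ) * F y :=
  (u.integrable.ofReal (𝕜 := ℂ)).mul_bdd (c := C) hc.aestronglyMeasurable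
    (Eventually.of_forall hC)

/-- Contracting the vector equation with `λ²` gives the scalar equation, whose bounded solution is
unique; the column is then an explicit integral of that scalar. -/
theorem IsJostColumn.eq_jostVector (hk : 0 < k) {v : ℝ → Fin 3 → ℂ} (hv : IsJostColumn u k j v) :
    v = jostVector u hj k := by
  obtain ⟨hc, ⟨C, hC⟩, he⟩ := hv
  simp only [jost_integral_eq] at he
  set F : ℝ → ℂ := fun y => ∑ m, lam m ^ 2 * v y m with hF
  have hFc : Continuous F := by fun_prop
  have hFb : ∀ x, ‖F x‖ ≤ 3 * C := by
    intro x
    have h : ∀ m ∈ Finset.univ, ‖lam m ^ 2 * v x m‖ ≤ C := by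
      intro m _
      rw [norm_mul, norm_pow, norm_lam, one_pow, one_mul]
      exact (norm_le_pi_norm (v x) m).trans (hC x)
    simpa using norm_sum_le_of_le _ h
  have hs : IsVolterraSolution u j k F := by
    intro x
    have h1 : F x = ∑ m, lam m ^ 2 * v x m := rfl
    rw [h1, Finset.sum_congr rfl fun m _ => by rw [he x m]]
    simp only [mul_add, Finset.sum_add_distrib, sum_lam_sq_mul_one]
    rw [sum_integral_exp_mul hj hk x (integrable_schwartz_mul u hFc hFb)]
  have hFe := eq_jostDensity u hj hk.le hs hFc hFb
  funext x i
  rw [he x i, jostVector, ← hFe]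

theorem existsUnique_isJostColumn {j : Fin 3} (hj : j ≠ 2) (hk : 0 < k) : ∃! v, IsJostColumn u k j v :=
  ⟨_, isJostColumn_jostVector u hj hk, fun _ hv => hv.eq_jostVector u hj hk⟩

theorem jostColumn_eq (hk : 0 < k) : jostColumn u k j = jostVector u hj k := by
  have h : ∃ v, IsJostColumn u k j v := ⟨_, isJostColumn_jostVector u hj hk⟩
  rw [jostColumn, dif_pos h]
  exact h.choose_spec.eq_jostVector u hj hk

theorem s_zero_eq (hk : 0 < k) :
    s u k 0 j = (1 : Matrix (Fin 3) (Fin 3) ℂ) 0 j + scatteringIntegral u hj k / k := by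
  simp only [s, Q_mulVec, jostColumn_eq u hj hk, sum_lam_sq_mul_jostVector u hj hk,
    mul_left_comm _ (-(2 / (k : ℂ))), integral_const_mul, scatteringIntegral]
  ring

end JostColumns

/-! ### Reduction of the cofactor problem to the Jost problem at `-k`. -/

section CofactorColumns

variable {j : Fin 3} (u : ℝ → ℝ) (k : ℂ)

/-- Conjugation by `Λ²` turns cofactor Jost columns at `k` into Jost columns at `-k`. -/
theorem isCofactorJostColumn_iff (w : ℝ → Fin 3 → ℂ) :
    IsCofactorJostColumn u k j w ↔
      IsJostColumn u (-k) j fun x i => lam j ^ 2 / lam i ^ 2 * w x i := by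
  have hl := lam_ne_zero
  -- The diagonal factors are unimodular, so boundedness transfers in both directions.
  have hn : ∀ x, ‖fun i => lam j ^ 2 / lam i ^ 2 * w x i‖ = ‖w x‖ := by
    intro x
    simp [Pi.norm_def, nnnorm_mul, nnnorm_div, nnnorm_pow,
      show ∀ i, ‖lam i‖₊ = 1 from fun i => NNReal.eq (norm_lam i)]
  refine and_congr ?_ (and_congr (by simp only [hn]) (forall₂_congr fun x i => ?_))
  · rw [continuous_pi_iff, continuous_pi_iff]
    refine forall_congr' fun i => ⟨fun h => continuous_const.mul h, fun h => ?_⟩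
    have := (continuous_const (y := lam i ^ 2 / lam j ^ 2)).mul h
    refine this.congr fun x => ?_
    have := hl i
    have := hl j
    simp only [Pi.mul_apply]
    field_simp
  · have h1 : ∀ y, ∑ m, lam m ^ 2 * (lam j ^ 2 / lam m ^ 2 * w y m) = lam j ^ 2 * ∑ m, w y m := by
      intro y
      rw [Finset.mul_sum]
      refine Finset.sum_congr rfl fun m _ => ?_
      have := hl m
      field_simp
    have h2 : ∀ y : ℝ, ((x - y : ℝ) : ℂ) * -k * (lam i - lam j)
        = -(((x - y : ℝ) : ℂ) * k * (lam i - lam j)) := fun y => by ring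
    have h3 : ∀ y, Complex.exp (-(((x - y : ℝ) : ℂ) * k * (lam i - lam j))) *
          (-(2 / -k) * ((u y : ℂ) * (lam j ^ 2 * ∑ m, w y m)))
        = -(lam j ^ 2 / lam i ^ 2) * (Complex.exp (-(((x - y : ℝ) : ℂ) * k * (lam i - lam j))) *
          (-(2 / k) * (lam i ^ 2 * ((u y : ℂ) * ∑ m, w y m)))) := by
      intro y
      have := hl i
      rw [div_neg]
      field_simp
    have h4 : (1 : Matrix (Fin 3) (Fin 3) ℂ) i j
        = lam j ^ 2 / lam i ^ 2 * (1 : Matrix (Fin 3) (Fin 3) ℂ) i j := by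
      rw [Matrix.one_apply]
      split_ifs with h
      · rw [h, div_self (pow_ne_zero 2 (hl j)), one_mul]
      · simp
    simp only [Q_mulVec, Q_transpose_mulVec, h1, h2, h3, integral_const_mul]
    have hne : lam j ^ 2 / lam i ^ 2 ≠ 0 :=
      div_ne_zero (pow_ne_zero 2 (hl j)) (pow_ne_zero 2 (hl i))
    rw [neg_mul, sub_neg_eq_add]
    nth_rw 2 [h4]
    rw [← mul_add, mul_right_inj' hne]

theorem isCofactorJostColumn_of_isJostColumn {v : ℝ → Fin 3 → ℂ} (hv : IsJostColumn u (-k) j v) :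
    IsCofactorJostColumn u k j fun x i => lam i ^ 2 / lam j ^ 2 * v x i := by
  rw [isCofactorJostColumn_iff]
  convert hv using 3 with x i
  have := lam_ne_zero i
  have := lam_ne_zero j
  field_simp

theorem existsUnique_isCofactorJostColumn (h : ∃! v, IsJostColumn u (-k) j v) :
    ∃! w, IsCofactorJostColumn u k j w := by
  obtain ⟨v, hv, huv⟩ := h
  refine ⟨_, isCofactorJostColumn_of_isJostColumn u k hv, fun w hw => ?_⟩
  have h1 := huv _ ((isCofactorJostColumn_iff u k w).1 hw)
  funext x i
  have h2 := congrFun (congrFun h1 x) i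
  have := lam_ne_zero i
  have := lam_ne_zero j
  rw [← h2]
  field_simp

theorem cofactorJostColumn_eq (h : ∃! v, IsJostColumn u (-k) j v) (x : ℝ) (i : Fin 3) :
    cofactorJostColumn u k j x i = lam i ^ 2 / lam j ^ 2 * jostColumn u (-k) j x i := by
  have hw := existsUnique_isCofactorJostColumn u k h
  have e1 : IsCofactorJostColumn u k j (cofactorJostColumn u k j) := by
    rw [cofactorJostColumn, dif_pos hw.exists]
    exact hw.exists.choose_spec
  have e2 : IsJostColumn u (-k) j (jostColumn u (-k) j) := by
    rw [jostColumn, dif_pos h.exists]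
    exact h.exists.choose_spec
  exact congrFun (congrFun (hw.unique e1 (isCofactorJostColumn_of_isJostColumn u k e2)) x) i

theorem sA_eq (h : ∃! v, IsJostColumn u (-k) j v) (i : Fin 3) :
    sA u k i j = lam i ^ 2 / lam j ^ 2 * s u (-k) i j := by
  have hl := lam_ne_zero
  have h1 : ∀ y, ∑ m, lam m ^ 2 / lam j ^ 2 * jostColumn u (-k) j y m
      = (lam j ^ 2)⁻¹ * ∑ m, lam m ^ 2 * jostColumn u (-k) j y m := by
    intro y
    rw [Finset.mul_sum]
    exact Finset.sum_congr rfl fun m _ => by ring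
  have h2 : ∀ y : ℝ, -((y : ℂ) * -k * (lam i - lam j))
      = (y : ℂ) * k * (lam i - lam j) := fun y => by ring
  have h4 : (1 : Matrix (Fin 3) (Fin 3) ℂ) i j
      = lam i ^ 2 / lam j ^ 2 * (1 : Matrix (Fin 3) (Fin 3) ℂ) i j := by
    rw [Matrix.one_apply]
    split_ifs with h
    · rw [h, div_self (pow_ne_zero 2 (hl j)), one_mul]
    · simp
  simp only [sA, s, Q_mulVec, Q_transpose_mulVec, cofactorJostColumn_eq u k h, h1, h2]
  rw [mul_sub, ← h4, sub_eq_add_neg (_ : ℂ) (lam i ^ 2 / lam j ^ 2 * _), ← neg_mul,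
    ← integral_const_mul]
  congr 2
  funext y
  rw [div_neg]
  ring

end CofactorColumns

/-! ### Rapid decay of the second scattering integral by integration by parts. -/

section Oscillatory

theorem hasDerivAt_integral_Ioi {g : ℝ → ℂ} (hc : Continuous g)
    (hg : ∀ x, IntegrableOn g (Ioi x)) (x : ℝ) :
    HasDerivAt (fun x => ∫ y in Ioi x, g y) (-g x) x := by
  have h1 : HasDerivAt (fun t => (∫ y in Ioi x, g y) - ∫ y in x..t, g y) (-g x) x := by
    exact (intervalIntegral.integral_hasDerivAt_right (hc.intervalIntegrable x x)
      (hc.stronglyMeasurableAtFilter _ _) hc.continuousAt).const_sub _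
  refine h1.congr_of_eventuallyEq (Eventually.of_forall fun t => ?_)
  simp only
  rw [← intervalIntegral.integral_Ioi_sub_Ioi' (hg x) (hg t), sub_sub_cancel]

/-- The antiderivative of a Schwartz function that vanishes at `-∞`. -/
def antideriv (h : 𝓢(ℝ, ℂ)) (x : ℝ) : ℂ := ∫ y in Iic x, h y

theorem hasDerivAt_antideriv (h : 𝓢(ℝ, ℂ)) (x : ℝ) : HasDerivAt (antideriv h) (h x) x := by
  have h1 : HasDerivAt (fun t => (∫ y in Iic x, h y) + ∫ y in x..t, h y) (h x) x := by
    exact (intervalIntegral.integral_hasDerivAt_right (h.continuous.intervalIntegrable x x)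
      (h.continuous.stronglyMeasurableAtFilter _ _) h.continuous.continuousAt).const_add _
  refine h1.congr_of_eventuallyEq (Eventually.of_forall fun t => ?_)
  simp only
  rw [← intervalIntegral.integral_Iic_sub_Iic h.integrable.integrableOn h.integrable.integrableOn,
    add_sub_cancel]
  rfl

theorem norm_antideriv_le (h : 𝓢(ℝ, ℂ)) (x : ℝ) : ‖antideriv h x‖ ≤ ∫ y, ‖h y‖ :=
  (norm_integral_le_integral_norm _).trans
    (setIntegral_le_integral h.integrable.norm (Eventually.of_forall fun _ => norm_nonneg _))

/-- An antiderivative of a Schwartz function need not decay at `+∞`, but multiplying it by `u` gives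
a Schwartz function again, so the class of amplitudes is stable under the integrations by parts. -/
theorem hasTemperateGrowth_antideriv (h : 𝓢(ℝ, ℂ)) :
    Function.HasTemperateGrowth (antideriv h) := by
  refine Function.HasTemperateGrowth.of_fderiv ?_
    (fun x => (hasDerivAt_antideriv h x).differentiableAt) (k := 0) (C := ∫ y, ‖h y‖)
    (fun x => by simpa using norm_antideriv_le h x)
  have e : fderiv ℝ (antideriv h) = fun x => ContinuousLinearMap.smulRightL ℝ ℝ ℂ
      (ContinuousLinearMap.id ℝ ℝ) (h x) := by
    ext x
    simp [(hasDerivAt_antideriv h x).hasFDerivAt.fderiv]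
  rw [e]
  exact (ContinuousLinearMap.hasTemperateGrowth _).comp h.hasTemperateGrowth

variable (u : 𝓢(ℝ, ℝ))

/-- The product of `u` with a function of temperate growth. -/
def schwartzMul {g : ℝ → ℂ} (hg : g.HasTemperateGrowth) : 𝓢(ℝ, ℂ) :=
  SchwartzMap.bilinLeftCLM (ContinuousLinearMap.lsmul ℝ ℝ : ℝ →L[ℝ] ℂ →L[ℝ] ℂ) hg u

theorem schwartzMul_apply {g : ℝ → ℂ} (hg : g.HasTemperateGrowth) (x : ℝ) :
    schwartzMul u hg x = u x * g x := by
  rw [schwartzMul, SchwartzMap.bilinLeftCLM_apply]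
  simp

/-- The derivative of a Schwartz function. -/
abbrev schwartzDeriv (h : 𝓢(ℝ, ℂ)) : 𝓢(ℝ, ℂ) := SchwartzMap.derivCLM ℝ ℂ h

theorem hasDerivAt_schwartz (h : 𝓢(ℝ, ℂ)) (x : ℝ) : HasDerivAt h (schwartzDeriv h x) x := by
  rw [SchwartzMap.derivCLM_apply]
  exact h.differentiableAt.hasDerivAt

theorem one_ne_two_fin : (1 : Fin 3) ≠ 2 := by decide

/-- The oscillating factor in `s₁₂`. -/
def phase (k x : ℝ) : ℂ := Complex.exp (-((x : ℂ) * k * (lam 0 - lam 1)))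

theorem norm_phase (k x : ℝ) : ‖phase k x‖ = 1 := norm_exp_mul_lam_zero_sub one_ne_two_fin x k

theorem continuous_phase (k : ℝ) : Continuous (phase k) := by
  unfold phase
  fun_prop

theorem hasDerivAt_phase (k x : ℝ) :
    HasDerivAt (phase k) (-(k * (lam 0 - lam 1)) * phase k x) x := by
  have h1 : HasDerivAt (fun x : ℝ => -((x : ℂ) * k * (lam 0 - lam 1)))
      (-(k * (lam 0 - lam 1))) x := by
    have := (((Complex.ofRealCLM.hasDerivAt (x := x)).mul_const (k : ℂ)).mul_const
      (lam 0 - lam 1)).neg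
    simpa using! this
  convert! h1.cexp using 1
  rw [phase, mul_comm]

theorem lam_ne {i : Fin 3} (hi : i ≠ 0) : lam i - lam 0 ≠ 0 := by
  intro h
  have h1 : om ≠ 1 := fun h => by
    have := om_re
    rw [h] at this
    norm_num at this
  have h2 := om_ne_zero
  fin_cases i
  · exact hi rfl
  · simp only [Fin.mk_one, lam_one, lam_zero] at h
    have : om * (om - 1) = 0 := by linear_combination h
    rcases mul_eq_zero.1 this with h | h
    · exact h2 h
    · exact h1 (sub_eq_zero.1 h)
  · simp only [Fin.reduceFinMk, lam_two, lam_zero] at h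
    exact h1 (sub_eq_zero.1 h).symm

/-- The product of `u` with the density of the second Jost column. -/
def source (k x : ℝ) : ℂ := (u x : ℂ) * jostDensity u one_ne_two_fin k x

/-- The exponential tail integrals of `source`. -/
def expTail (i : Fin 3) (k x : ℝ) : ℂ :=
  ∫ y in Ioi x, Complex.exp (((x - y : ℝ) : ℂ) * k * (lam i - lam 1)) * source u k y

/-- `∫ E h f` with the oscillating factor `E` and the scalar density `f`. -/
def oscIntegral (h : 𝓢(ℝ, ℂ)) (k : ℝ) : ℂ :=
  ∫ x, phase k x * (h x * jostDensity u one_ne_two_fin k x)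

/-- `∫ h E W` with the oscillating factor `E` and the exponential tail `W`. -/
def tailIntegral (i : Fin 3) (h : 𝓢(ℝ, ℂ)) (k : ℝ) : ℂ :=
  ∫ x, h x * (phase k x * expTail u i k x)

variable {u}

theorem continuous_source (k : ℝ) : Continuous (source u k) :=
  continuous_mul_jostDensity u one_ne_two_fin k

theorem integrable_source {k : ℝ} (hk : 0 ≤ k) : Integrable (source u k) :=
  integrable_mul_jostDensity u one_ne_two_fin hk

theorem norm_expTail_le (i : Fin 3) {k : ℝ} (hk : 0 ≤ k) (x : ℝ) :
    ‖expTail u i k x‖ ≤ ∫ y, ‖source u k y‖ :=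
  norm_integral_exp_mul_le one_ne_two_fin hk i x (integrable_source hk)

theorem continuous_expTail (i : Fin 3) {k : ℝ} (hk : 0 ≤ k) : Continuous (expTail u i k) :=
  continuous_integral_exp_mul one_ne_two_fin hk i (integrable_source hk)

/-- The dependence on `x` separates into an exponential of rate `k(λᵢ-λ₀)` and a tail of a fixed
integrand. The rate vanishes exactly for `i = 0`, the resonant case. -/
theorem phase_mul_expTail (i : Fin 3) (k x : ℝ) :
    phase k x * expTail u i k x = Complex.exp ((x : ℂ) * (k * (lam i - lam 0))) *
      ∫ y in Ioi x, Complex.exp (-((y : ℂ) * (k * (lam i - lam 1)))) * source u k y := by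
  rw [phase, expTail, ← integral_const_mul, ← integral_const_mul]
  refine integral_congr_ae (Eventually.of_forall fun y => ?_)
  simp only [← mul_assoc, ← Complex.exp_add]
  congr 2
  push_cast; ring

theorem integrableOn_exp_neg_mul_source (i : Fin 3) {k : ℝ} (hk : 0 ≤ k) (x : ℝ) :
    IntegrableOn (fun y : ℝ => Complex.exp (-((y : ℂ) * (k * (lam i - lam 1)))) * source u k y)
      (Ioi x) := by
  have h := (integrableOn_exp_mul one_ne_two_fin hk i x (integrable_source (u := u) hk)).const_mul
    (Complex.exp (-((x : ℂ) * (k * (lam i - lam 1)))))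
  refine h.congr (Eventually.of_forall fun y => ?_)
  simp only [← mul_assoc, ← Complex.exp_add]
  congr 2
  push_cast; ring

theorem hasDerivAt_phase_mul_expTail (i : Fin 3) {k : ℝ} (hk : 0 ≤ k) (x : ℝ) :
    HasDerivAt (fun x => phase k x * expTail u i k x)
      (k * (lam i - lam 0) * (phase k x * expTail u i k x) - phase k x * source u k x) x := by
  have h1 : HasDerivAt (fun x : ℝ => Complex.exp ((x : ℂ) * (k * (lam i - lam 0))))
      (Complex.exp ((x : ℂ) * (k * (lam i - lam 0))) * (k * (lam i - lam 0))) x := by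
    have := ((Complex.ofRealCLM.hasDerivAt (x := x)).mul_const (k * (lam i - lam 0))).cexp
    simpa using! this
  have hs := continuous_source (u := u) k
  have h2 := hasDerivAt_integral_Ioi (by fun_prop)
    (fun x => integrableOn_exp_neg_mul_source (u := u) i hk x) x
  have h3 := h1.mul h2
  have e : Complex.exp ((x : ℂ) * (k * (lam i - lam 0))) *
      Complex.exp (-((x : ℂ) * (k * (lam i - lam 1)))) = phase k x := by
    rw [phase, ← Complex.exp_add]
    congr 1; ring
  simp only [phase_mul_expTail]
  convert! h3 using 1
  rw [← e]
  ring

theorem oscIntegral_schwartzMul {g : ℝ → ℂ} (hg : g.HasTemperateGrowth) (k : ℝ) :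
    oscIntegral u (schwartzMul u hg) k = ∫ x, g x * (phase k x * source u k x) := by
  refine integral_congr_ae (Eventually.of_forall fun x => ?_)
  simp only [schwartzMul_apply, source]
  ring

theorem integrable_mul_phase_source {g : ℝ → ℂ} (hc : Continuous g) {C : ℝ}
    (hC : ∀ x, ‖g x‖ ≤ C) {k : ℝ} (hk : 0 ≤ k) :
    Integrable fun x => g x * (phase k x * source u k x) :=
  ((integrable_source hk).bdd_mul (c := 1) (continuous_phase k).aestronglyMeasurable
    (Eventually.of_forall fun x => (norm_phase k x).le)).bdd_mul (c := C) hc.aestronglyMeasurable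
    (Eventually.of_forall hC)

theorem continuous_phase_mul_expTail (i : Fin 3) {k : ℝ} (hk : 0 ≤ k) :
    Continuous fun x => phase k x * expTail u i k x :=
  (continuous_phase k).mul (continuous_expTail i hk)

theorem norm_phase_mul_expTail_le (i : Fin 3) {k : ℝ} (hk : 0 ≤ k) (x : ℝ) :
    ‖phase k x * expTail u i k x‖ ≤ ∫ y, ‖source u k y‖ := by
  rw [norm_mul, norm_phase, one_mul]
  exact norm_expTail_le i hk x

theorem integrable_schwartz_mul_phase_expTail (h : 𝓢(ℝ, ℂ)) (i : Fin 3) {k : ℝ} (hk : 0 ≤ k) :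
    Integrable fun x => h x * (phase k x * expTail u i k x) :=
  h.integrable.mul_bdd (c := ∫ y, ‖source u k y‖)
    (continuous_phase_mul_expTail i hk).aestronglyMeasurable
    (Eventually.of_forall fun x => norm_phase_mul_expTail_le i hk x)

theorem exists_norm_le_schwartz (h : 𝓢(ℝ, ℂ)) : ∃ C, ∀ x, ‖h x‖ ≤ C := by
  simpa using schwartz_decay h 0

/-- Integration by parts against the non-resonant exponentials. -/
theorem tailIntegral_eq (h : 𝓢(ℝ, ℂ)) (i : Fin 3) {k : ℝ} (hk : 0 ≤ k) :
    k * (lam i - lam 0) * tailIntegral u i h k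
      = oscIntegral u (schwartzMul u h.hasTemperateGrowth) k
        - tailIntegral u i (schwartzDeriv h) k := by
  obtain ⟨C, hC⟩ := exists_norm_le_schwartz h
  have i1 := integrable_schwartz_mul_phase_expTail (u := u) h i hk
  have i2 := integrable_mul_phase_source (u := u) h.continuous hC hk
  have e1 : ∀ x, h x * (k * (lam i - lam 0) * (phase k x * expTail u i k x)
        - phase k x * source u k x)
      = k * (lam i - lam 0) * (h x * (phase k x * expTail u i k x))
        - h x * (phase k x * source u k x) := fun x => by ring
  have h1 := integral_mul_deriv_eq_deriv_mul_of_integrable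
    (fun x _ => hasDerivAt_schwartz h x)
    (fun x _ => hasDerivAt_phase_mul_expTail (u := u) i hk x)
    (((i1.const_mul _).sub i2).congr (Eventually.of_forall fun x => (e1 x).symm))
    (integrable_schwartz_mul_phase_expTail _ i hk) i1
  simp only [e1] at h1
  rw [integral_sub (i1.const_mul _) i2, integral_const_mul] at h1
  rw [oscIntegral_schwartzMul, tailIntegral, tailIntegral]
  linear_combination h1

/-- Integration by parts against the resonant exponential. -/
theorem tailIntegral_zero (h : 𝓢(ℝ, ℂ)) {k : ℝ} (hk : 0 ≤ k) :
    tailIntegral u 0 h k = oscIntegral u (schwartzMul u (hasTemperateGrowth_antideriv h)) k := by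
  have hc : Continuous (antideriv h) :=
    continuous_iff_continuousAt.2 fun x => (hasDerivAt_antideriv h x).continuousAt
  have i2 := integrable_mul_phase_source (u := u) hc (norm_antideriv_le h) hk
  have hd : ∀ x, HasDerivAt (fun x => phase k x * expTail u 0 k x)
      (-(phase k x * source u k x)) x := by
    intro x
    simpa using! hasDerivAt_phase_mul_expTail (u := u) 0 hk x
  -- The boundary terms vanish for different reasons: at `-∞` the antiderivative tends to zero, at
  -- `+∞` the tail integral does.
  have hbot : Tendsto (antideriv h * fun x => phase k x * expTail u 0 k x) atBot (𝓝 0) := by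
    refine squeeze_zero_norm (a := fun x => ‖antideriv h x‖ * ∫ y, ‖source u k y‖) (fun x => ?_) ?_
    · rw [Pi.mul_apply, norm_mul]
      exact mul_le_mul_of_nonneg_left (norm_phase_mul_expTail_le 0 hk x) (norm_nonneg _)
    · have := (tendsto_integral_Iic_zero (f := h) (μ := volume) tendsto_id).norm.mul_const
        (∫ y, ‖source u k y‖)
      simpa using! this
  have htop : Tendsto (antideriv h * fun x => phase k x * expTail u 0 k x) atTop (𝓝 0) := by
    refine squeeze_zero_norm
      (a := fun x => (∫ y, ‖h y‖) * ‖∫ y in Ioi x, phase k y * source u k y‖) (fun x => ?_) ?_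
    · rw [Pi.mul_apply, norm_mul, phase_mul_expTail, sub_self, mul_zero, mul_zero,
        Complex.exp_zero, one_mul]
      refine mul_le_mul (norm_antideriv_le h x) (le_of_eq ?_) (norm_nonneg _)
        (integral_nonneg fun _ => norm_nonneg _)
      simp only [phase, mul_assoc]
    · have := (tendsto_integral_Ioi_zero (f := fun y => phase k y * source u k y) (μ := volume)
        tendsto_id).norm.const_mul (∫ y, ‖h y‖)
      simpa using! this
  have h1 := integral_mul_deriv_eq_deriv_mul
    (fun x _ => hasDerivAt_antideriv h x) (fun x _ => hd x)
    (i2.neg.congr (Eventually.of_forall fun x => by simp))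
    (integrable_schwartz_mul_phase_expTail h 0 hk) hbot htop
  rw [oscIntegral_schwartzMul, tailIntegral]
  simp only [mul_neg, integral_neg] at h1
  linear_combination h1

theorem integrable_schwartz_mul_phase (h : 𝓢(ℝ, ℂ)) (k : ℝ) :
    Integrable fun x => h x * phase k x :=
  h.integrable.mul_bdd (c := 1) (continuous_phase k).aestronglyMeasurable
    (Eventually.of_forall fun x => (norm_phase k x).le)

/-- Insert the equation for the density, `λ₁² + (2/k) ∑ λᵢ² Wᵢ` with `Wᵢ` the exponential tails; the
factor `1/k` is the gain of one order. -/
theorem oscIntegral_eq (h : 𝓢(ℝ, ℂ)) {k : ℝ} (hk : 0 < k) :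
    k * oscIntegral u h k = lam 1 ^ 2 * (k * ∫ x, h x * phase k x)
      + 2 * ∑ i, lam i ^ 2 * tailIntegral u i h k := by
  have hk0 : (k : ℂ) ≠ 0 := Complex.ofReal_ne_zero.2 hk.ne'
  have e1 : ∀ x, phase k x * (h x * jostDensity u one_ne_two_fin k x)
      = lam 1 ^ 2 * (h x * phase k x)
        + ∑ i, (2 / k) * lam i ^ 2 * (h x * (phase k x * expTail u i k x)) := by
    intro x
    rw [← sum_lam_sq_mul_jostVector u one_ne_two_fin hk x]
    simp only [jostVector, mul_add, Finset.sum_add_distrib, sum_lam_sq_mul_one]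
    rw [Finset.mul_sum, Finset.mul_sum]
    congr 1
    · ring
    · refine Finset.sum_congr rfl fun i _ => ?_
      rw [expTail]
      simp only [source]
      ring
  have i1 := fun i => (integrable_schwartz_mul_phase_expTail (u := u) h i hk.le).const_mul
    ((2 / k : ℂ) * lam i ^ 2)
  rw [oscIntegral]
  simp only [e1]
  rw [integral_add ((integrable_schwartz_mul_phase h k).const_mul _)
      (integrable_finsetSum _ fun i _ => i1 i), integral_finsetSum _ fun i _ => i1 i]
  simp only [integral_const_mul, ← tailIntegral.eq_def]
  rw [mul_add, Finset.mul_sum, Finset.mul_sum]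
  congr 1
  · ring
  · refine Finset.sum_congr rfl fun i _ => ?_
    field_simp

/-- Away from `k = 0` the factor `2/k` in the Jost vector is harmless, so no weight is needed. -/
theorem exists_norm_jostDensity_le :
    ∃ C, ∀ k x, 1 ≤ k → ‖jostDensity u one_ne_two_fin k x‖ ≤ C := by
  obtain ⟨C, hC⟩ := exists_integral_norm_mul_jostDensity_le u one_ne_two_fin
  refine ⟨3 * (1 + 2 * C), fun k x hk => ?_⟩
  have hk0 : 0 < k := one_pos.trans_le hk
  rw [← sum_lam_sq_mul_jostVector u one_ne_two_fin hk0 x]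
  have h : ∀ m ∈ Finset.univ, ‖lam m ^ 2 * jostVector u one_ne_two_fin k x m‖ ≤ 1 + 2 * C := by
    intro m _
    rw [norm_mul, norm_pow, norm_lam, one_pow, one_mul]
    refine (norm_jostVector_le u one_ne_two_fin hk0 x m).trans ?_
    have h1 := hC k hk0.le
    have h2 : 2 / k ≤ 2 := div_le_self zero_le_two hk
    have h3 : 0 ≤ ∫ y, ‖(u y : ℂ) * jostDensity u one_ne_two_fin k y‖ :=
      integral_nonneg fun _ => norm_nonneg _
    gcongr
  refine (norm_sum_le_of_le _ h).trans (le_of_eq ?_)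
  rw [Finset.sum_const, Finset.card_univ, Fintype.card_fin, nsmul_eq_mul, Nat.cast_ofNat]

/-- `f = O(k^{-N})` on `[1, ∞)`. -/
def DecayOrder (N : ℕ) (f : ℝ → ℂ) : Prop := ∃ C, ∀ k : ℝ, 1 ≤ k → k ^ N * ‖f k‖ ≤ C

theorem DecayOrder.add {N : ℕ} {f g : ℝ → ℂ} (hf : DecayOrder N f) (hg : DecayOrder N g) :
    DecayOrder N fun k => f k + g k := by
  obtain ⟨C, hC⟩ := hf
  obtain ⟨D, hD⟩ := hg
  refine ⟨C + D, fun k hk => ?_⟩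
  calc k ^ N * ‖f k + g k‖ ≤ k ^ N * (‖f k‖ + ‖g k‖) := by
        have := norm_add_le (f k) (g k)
        gcongr
    _ = k ^ N * ‖f k‖ + k ^ N * ‖g k‖ := mul_add _ _ _
    _ ≤ _ := add_le_add (hC k hk) (hD k hk)

theorem DecayOrder.const_mul {N : ℕ} {f : ℝ → ℂ} (hf : DecayOrder N f) (c : ℂ) :
    DecayOrder N fun k => c * f k := by
  obtain ⟨C, hC⟩ := hf
  refine ⟨‖c‖ * C, fun k hk => ?_⟩
  rw [norm_mul, mul_left_comm]
  exact mul_le_mul_of_nonneg_left (hC k hk) (norm_nonneg _)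

theorem DecayOrder.congr {N : ℕ} {f g : ℝ → ℂ} (hf : DecayOrder N f)
    (hfg : ∀ k, 1 ≤ k → g k = f k) : DecayOrder N g := by
  obtain ⟨C, hC⟩ := hf
  exact ⟨C, fun k hk => by rw [hfg k hk]; exact hC k hk⟩

theorem DecayOrder.sum {N : ℕ} {f : Fin 3 → ℝ → ℂ} (hf : ∀ i, DecayOrder N (f i)) :
    DecayOrder N fun k => ∑ i, f i k := by
  simp only [Fin.sum_univ_three]
  exact ((hf 0).add (hf 1)).add (hf 2)

theorem DecayOrder.succ {N : ℕ} {f : ℝ → ℂ} (hf : DecayOrder N fun k => k * f k) :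
    DecayOrder (N + 1) f := by
  obtain ⟨C, hC⟩ := hf
  refine ⟨C, fun k hk => ?_⟩
  have := hC k hk
  rw [norm_mul, Complex.norm_real, Real.norm_of_nonneg (zero_le_one.trans hk)] at this
  rw [pow_succ, mul_assoc]
  exact this

theorem fourier_decay (N : ℕ) (h : 𝓢(ℝ, ℂ)) :
    DecayOrder N fun k => ∫ x, h x * phase k x := by
  induction N generalizing h with
  | zero =>
    refine ⟨∫ x, ‖h x‖, fun k _ => ?_⟩
    rw [pow_zero, one_mul]
    refine (norm_integral_le_integral_norm _).trans (le_of_eq ?_)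
    simp only [norm_mul, norm_phase, mul_one]
  | succ N ih =>
    have hq : lam 1 - lam 0 ≠ 0 := lam_ne (by decide)
    refine (((ih (schwartzDeriv h)).const_mul (-(lam 1 - lam 0)⁻¹)).congr fun k _ => ?_).succ
    have e1 : ∀ x, h x * (-(k * (lam 0 - lam 1)) * phase k x)
        = k * (lam 1 - lam 0) * (h x * phase k x) := fun x => by ring
    have i1 := integrable_schwartz_mul_phase h k
    have h1 := integral_mul_deriv_eq_deriv_mul_of_integrable
      (fun x _ => hasDerivAt_schwartz h x) (fun x _ => hasDerivAt_phase k x)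
      ((i1.const_mul _).congr (Eventually.of_forall fun x => (e1 x).symm))
      (integrable_schwartz_mul_phase _ k) i1
    simp only [e1, integral_const_mul] at h1
    have h2 : ∫ x, schwartzDeriv h x * phase k x
        = -(k * (lam 1 - lam 0) * ∫ x, h x * phase k x) := by rw [h1, neg_neg]
    rw [h2]
    field_simp

/-- A simultaneous induction over all Schwartz amplitudes. The oscillatory integral gains an order
from `oscIntegral_eq`. A non-resonant tail gains one by parts from quantities of order `N`. The
resonant tail gains nothing by itself, but equals an oscillatory integral with another amplitude,
already known at order `N + 1`. -/
theorem oscIntegral_decay (N : ℕ) :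
    (∀ h, DecayOrder N (oscIntegral u h)) ∧ ∀ i h, DecayOrder N (tailIntegral u i h) := by
  induction N with
  | zero =>
    refine ⟨fun h => ?_, fun i h => ?_⟩
    · obtain ⟨C, hC⟩ := exists_norm_jostDensity_le (u := u)
      refine ⟨∫ x, ‖h x‖ * C, fun k hk => ?_⟩
      rw [pow_zero, one_mul]
      refine norm_integral_le_of_norm_le (h.integrable.norm.mul_const C)
        (Eventually.of_forall fun x => ?_)
      rw [norm_mul, norm_phase, one_mul, norm_mul]
      exact mul_le_mul_of_nonneg_left (hC k x hk) (norm_nonneg _)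
    · obtain ⟨C, hC⟩ := exists_integral_norm_mul_jostDensity_le u one_ne_two_fin
      refine ⟨∫ x, ‖h x‖ * C, fun k hk => ?_⟩
      have hk0 : 0 ≤ k := zero_le_one.trans hk
      rw [pow_zero, one_mul]
      refine norm_integral_le_of_norm_le (h.integrable.norm.mul_const C)
        (Eventually.of_forall fun x => ?_)
      rw [norm_mul]
      exact mul_le_mul_of_nonneg_left ((norm_phase_mul_expTail_le i hk0 x).trans (hC k hk0))
        (norm_nonneg _)
  | succ N ih =>
    have hosc : ∀ h, DecayOrder (N + 1) (oscIntegral u h) := by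
      intro h
      -- The Fourier term carries a factor `k` in `oscIntegral_eq`, which costs one of its orders.
      have h1 := ((fourier_decay (N + 1) h).const_mul (lam 1 ^ 2))
      have h2 : DecayOrder N fun k => k * (lam 1 ^ 2 * ∫ x, h x * phase k x) := by
        obtain ⟨C, hC⟩ := h1
        refine ⟨C, fun k hk => ?_⟩
        have := hC k hk
        rw [norm_mul, Complex.norm_real, Real.norm_of_nonneg (zero_le_one.trans hk), ← mul_assoc,
          ← pow_succ]
        exact this
      have h3 := (DecayOrder.sum fun i => (ih.2 i h).const_mul (lam i ^ 2)).const_mul 2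
      refine ((h2.add h3).congr fun k hk => ?_).succ
      rw [oscIntegral_eq h (one_pos.trans_le hk)]
      ring
    refine ⟨hosc, fun i h => ?_⟩
    by_cases hi : i = 0
    · subst hi
      exact (hosc (schwartzMul u (hasTemperateGrowth_antideriv h))).congr fun k hk =>
        tailIntegral_zero h (zero_le_one.trans hk)
    · have hne := lam_ne hi
      refine ((((ih.1 (schwartzMul u h.hasTemperateGrowth)).add
        ((ih.2 i (schwartzDeriv h)).const_mul (-1))).const_mul (lam i - lam 0)⁻¹).congr
        fun k hk => ?_).succ
      have h1 := tailIntegral_eq (u := u) h i (zero_le_one.trans hk)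
      have h2 : oscIntegral u (schwartzMul u h.hasTemperateGrowth) k
          + -1 * tailIntegral u i (schwartzDeriv h) k
          = k * (lam i - lam 0) * tailIntegral u i h k := by rw [h1]; ring
      rw [h2]
      field_simp

theorem rapidDecay_scatteringIntegral : RapidDecay (scatteringIntegral u one_ne_two_fin) := by
  intro m
  have hg : Function.HasTemperateGrowth (fun _ : ℝ => (1 : ℂ)) :=
    Function.HasTemperateGrowth.const 1
  obtain ⟨C, hC⟩ := (oscIntegral_decay (u := u) m).1 (schwartzMul u hg)
  obtain ⟨D, hD⟩ := (boundedDerivs_scatteringIntegral u one_ne_two_fin 0).bounded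
  refine ⟨2 ^ m * (2 * |C|) + 2 ^ m * D, fun k hk => ?_⟩
  have hk0 : (0 : ℝ) ≤ k := hk
  have hD0 : 0 ≤ D := (norm_nonneg _).trans (hD k hk)
  -- For `k ≥ 1` one has `1 + k ≤ 2k` and the oscillatory estimate applies; on `[0, 1]` boundedness
  -- suffices.
  rcases le_total 1 k with h1 | h1
  · have e : scatteringIntegral u one_ne_two_fin k = 2 * oscIntegral u (schwartzMul u hg) k := by
      rw [scatteringIntegral, oscIntegral]
      congr 1
      refine integral_congr_ae (Eventually.of_forall fun x => ?_)
      simp only [schwartzMul_apply, phase, mul_one]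
    rw [e, norm_mul, Complex.norm_ofNat]
    calc (1 + k) ^ m * (2 * ‖oscIntegral u (schwartzMul u hg) k‖)
        ≤ (2 * k) ^ m * (2 * ‖oscIntegral u (schwartzMul u hg) k‖) := by gcongr; linarith
      _ = 2 ^ m * (2 * (k ^ m * ‖oscIntegral u (schwartzMul u hg) k‖)) := by rw [mul_pow]; ring
      _ ≤ 2 ^ m * (2 * |C|) := by
        have := (hC k h1).trans (le_abs_self C)
        gcongr
      _ ≤ _ := by
        have : 0 ≤ 2 ^ m * D := by positivity
        linarith
  · calc (1 + k) ^ m * ‖scatteringIntegral u one_ne_two_fin k‖ ≤ 2 ^ m * D := by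
          have := hD k hk
          gcongr
          linarith
      _ ≤ _ := by
        have : 0 ≤ 2 ^ m * (2 * |C|) := by positivity
        linarith

end Oscillatory

/-! ### The reflection coefficients and their values at the origin. -/

section ReflectionCoefficients

theorem isBigO_taylor {r R : ℝ → ℂ} {D : Set ℝ} (hD : Convex ℝ (insert 0 D)) (hR : EqOn R r D)
    (hc : ContDiffOn ℝ ∞ R (insert 0 D)) (N : ℕ) :
    (fun k : ℝ => r k - ∑ n ∈ Finset.range (N + 1),
      iteratedDerivWithin n R (insert 0 D) 0 / (n.factorial : ℂ) * (k : ℂ) ^ n)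
      =O[𝓝[D] 0] fun k : ℝ => k ^ (N + 1) := by
  -- Taylor's formula is taken one order higher than needed, with a little-o remainder, and its last
  -- term is then moved into the error.
  have h1 := (taylor_isLittleO (n := N + 1) hD (mem_insert 0 D)
    (hc.of_le (by exact_mod_cast le_top))).isBigO
  simp only [sub_zero, taylorWithinEval_succ] at h1
  have h2 : (fun k : ℝ => (((N : ℝ) + 1) * N.factorial)⁻¹ * k ^ (N + 1)) =O[𝓝[insert 0 D] 0]
      fun k : ℝ => k ^ (N + 1) := Asymptotics.isBigO_const_mul_self _ _ _
  have h3 : (fun k : ℝ => ((((N : ℝ) + 1) * N.factorial)⁻¹ * k ^ (N + 1)) •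
      iteratedDerivWithin (N + 1) R (insert 0 D) 0) =O[𝓝[insert 0 D] 0]
      fun k : ℝ => k ^ (N + 1) := by
    have := h2.smul (Asymptotics.isBigO_refl
      (fun _ : ℝ => iteratedDerivWithin (N + 1) R (insert 0 D) 0) (𝓝[insert 0 D] 0))
    refine this.trans (Asymptotics.IsBigO.of_bound
      ‖iteratedDerivWithin (N + 1) R (insert 0 D) 0‖ (Eventually.of_forall fun k => ?_))
    rw [norm_smul, mul_comm]
  refine ((h1.add h3).mono (nhdsWithin_mono 0 (subset_insert 0 D))).congr' ?_ EventuallyEq.rfl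
  filter_upwards [self_mem_nhdsWithin] with k hk
  rw [hR hk, taylor_within_apply, sub_add_eq_sub_sub, sub_add_cancel]
  congr 1
  refine Finset.sum_congr rfl fun n _ => ?_
  rw [Complex.real_smul, sub_zero]
  push_cast
  ring

theorem SmoothRapidlyDecreasingOn.congr {r R : ℝ → ℂ} {D : Set ℝ} (hD : IsOpen D)
    (h : SmoothRapidlyDecreasingOn R D) (hr : EqOn r R D) : SmoothRapidlyDecreasingOn r D := by
  refine ⟨h.1.congr hr, fun m n => ?_⟩
  obtain ⟨C, hC⟩ := h.2 m n
  refine ⟨C, fun k hk => ?_⟩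
  rw [(hr.eventuallyEq_of_mem (hD.mem_nhds hk)).iteratedDeriv_eq n]
  exact hC k hk

theorem SmoothRapidlyDecreasingOn.reflect {r : ℝ → ℂ} (h : SmoothRapidlyDecreasingOn r (Ioi 0))
    (c : ℂ) : SmoothRapidlyDecreasingOn (fun k => c * r (-k)) (Iio 0) := by
  have hmaps : MapsTo (fun k : ℝ => -k) (Iio 0) (Ioi 0) := fun k hk => by
    simpa using hk
  refine ⟨contDiffOn_const.mul (h.1.comp contDiff_neg.contDiffOn hmaps), fun m n => ?_⟩
  obtain ⟨C, hC⟩ := h.2 m n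
  refine ⟨‖c‖ * C, fun k hk => ?_⟩
  rw [iteratedDeriv_const_mul_field, iteratedDeriv_comp_neg, norm_mul, norm_smul, norm_pow,
    norm_neg, norm_one, one_pow, one_mul, mul_left_comm, ← abs_neg k]
  exact mul_le_mul_of_nonneg_left (hC (-k) (hmaps hk)) (norm_nonneg _)

theorem zero_ne_two_fin : (0 : Fin 3) ≠ 2 := by decide

variable (u : 𝓢(ℝ, ℝ))

/-- The denominator `k s₁₁(k)`, extended to `k = 0`. -/
def scatteringDenominator (k : ℝ) : ℂ := k + scatteringIntegral u zero_ne_two_fin k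

/-- The reflection coefficient `r₁`, extended to `k = 0`. -/
def reflection (k : ℝ) : ℂ :=
  scatteringIntegral u one_ne_two_fin k * Ring.inverse (scatteringDenominator u k)

variable {u}

theorem s_zero_zero_eq {k : ℝ} (hk : 0 < k) : s u k 0 0 = scatteringDenominator u k / k := by
  have hk0 : (k : ℂ) ≠ 0 := Complex.ofReal_ne_zero.2 hk.ne'
  rw [s_zero_eq u zero_ne_two_fin hk, scatteringDenominator, Matrix.one_apply_eq, add_div,
    div_self hk0]

theorem s_zero_one_eq {k : ℝ} (hk : 0 < k) :
    s u k 0 1 = scatteringIntegral u one_ne_two_fin k / k := by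
  rw [s_zero_eq u one_ne_two_fin hk, Matrix.one_apply_ne (by decide), zero_add]

theorem r₁_eq {k : ℝ} (hk : 0 < k) : r₁ u k = reflection u k := by
  have hk0 : (k : ℂ) ≠ 0 := Complex.ofReal_ne_zero.2 hk.ne'
  rw [r₁, s_zero_zero_eq hk, s_zero_one_eq hk, div_div_div_cancel_right₀ hk0, reflection,
    Ring.inverse_eq_inv', div_eq_mul_inv]

/-- Conjugation by `Λ²` leaves the diagonal entry unchanged and multiplies the off-diagonal one by
`λ₀²/λ₁² = ω^{-2} = ω`. -/
theorem r₂_eq {k : ℝ} (hk : k < 0) : r₂ u k = om * reflection u (-k) := by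
  have hk' : 0 < -k := neg_pos.2 hk
  have h0 := existsUnique_isJostColumn u zero_ne_two_fin hk'
  have h1 := existsUnique_isJostColumn u one_ne_two_fin hk'
  rw [Complex.ofReal_neg] at h0 h1
  have h4 : om ^ 2 / (om ^ 2) ^ 2 = om := by
    have := om_ne_zero
    field_simp
    linear_combination -om_cube
  rw [← r₁_eq hk', r₁, r₂, sA_eq u k h0, sA_eq u k h1, Complex.ofReal_neg, lam_zero, lam_one, h4,
    div_self (pow_ne_zero 2 om_ne_zero), one_mul, mul_div_assoc]

/-- The denominator is continuous on `[0,∞)` and equals `k s₁₁(k)` for `k > 0`, so genericity says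
precisely that its value at `0` is nonzero. -/
theorem scatteringDenominator_zero
    (h : ¬ Tendsto (fun k : ℝ => (k : ℂ) * s u k 0 0) (𝓝[>] 0) (𝓝 0)) :
    scatteringDenominator u 0 ≠ 0 := by
  intro h0
  apply h
  have hg : ContinuousWithinAt (scatteringDenominator u) (Ici 0) 0 :=
    Complex.continuous_ofReal.continuousWithinAt.add
      ((boundedDerivs_scatteringIntegral u zero_ne_two_fin 1).differentiableOn 0
        self_mem_Ici).continuousWithinAt
  have h1 := hg.tendsto.mono_left (nhdsWithin_mono 0 Ioi_subset_Ici_self)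
  rw [h0] at h1
  refine h1.congr' ?_
  filter_upwards [self_mem_nhdsWithin] with k hk
  rw [s_zero_zero_eq hk, mul_div_cancel₀ _ (Complex.ofReal_ne_zero.2 (ne_of_gt hk))]

section Generic

variable (hs : ∀ k : ℝ, 0 < k → s u k 0 0 ≠ 0)
  (hgen : ¬ Tendsto (fun k : ℝ => (k : ℂ) * s u k 0 0) (𝓝[>] 0) (𝓝 0))

include hs hgen

theorem scatteringDenominator_ne_zero {k : ℝ} (hk : 0 ≤ k) : scatteringDenominator u k ≠ 0 := by
  rcases hk.eq_or_lt with rfl | hk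
  · exact scatteringDenominator_zero hgen
  · intro h
    exact hs k hk (by rw [s_zero_zero_eq hk, h, zero_div])

/-- If `M` bounds the scattering integral, the denominator has modulus at least `k - M ≥ 1` for `k ≥
M + 1`. On the remaining compact interval it attains a positive minimum. -/
theorem exists_le_norm_scatteringDenominator :
    ∃ c > 0, ∀ k, 0 ≤ k → c ≤ ‖scatteringDenominator u k‖ := by
  have hg := boundedDerivs_scatteringIntegral u zero_ne_two_fin 1
  obtain ⟨M, hM⟩ := hg.bounded
  have hM0 : 0 ≤ M := (norm_nonneg _).trans (hM 0 self_mem_Ici)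
  have hcont : ContinuousOn (fun k => ‖scatteringDenominator u k‖) (Icc 0 (M + 1)) :=
    ((Complex.continuous_ofReal.continuousOn.add hg.differentiableOn.continuousOn).norm).mono
      Icc_subset_Ici_self
  obtain ⟨k₀, hk₀, hmin⟩ := isCompact_Icc.exists_isMinOn (nonempty_Icc.2 (by linarith)) hcont
  refine ⟨min 1 ‖scatteringDenominator u k₀‖, lt_min one_pos
    (norm_pos_iff.2 (scatteringDenominator_ne_zero hs hgen hk₀.1)), fun k hk => ?_⟩
  rcases le_total k (M + 1) with h | h
  · exact (min_le_right _ _).trans (hmin ⟨hk, h⟩)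
  · refine (min_le_left _ _).trans ?_
    have h1 := hM k hk
    have h2 := norm_sub_le_norm_add (k : ℂ) (scatteringIntegral u zero_ne_two_fin k)
    rw [Complex.norm_real, Real.norm_of_nonneg hk] at h2
    rw [scatteringDenominator]
    linarith

theorem exists_norm_inverse_le :
    ∃ C, ∀ k ∈ Ici (0 : ℝ), ‖Ring.inverse (scatteringDenominator u k)‖ ≤ C := by
  obtain ⟨c, hc, h⟩ := exists_le_norm_scatteringDenominator hs hgen
  refine ⟨c⁻¹, fun k hk => ?_⟩
  rw [Ring.inverse_eq_inv', norm_inv]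
  exact inv_anti₀ hc (h k hk)

theorem boundedDerivs_reflection (n : ℕ) : BoundedDerivs (Ici 0) n (reflection u) := by
  have hg := boundedDerivs_scatteringIntegral u zero_ne_two_fin (n + 1)
  have hd : ∀ k ∈ Ici (0 : ℝ), HasDerivWithinAt (scatteringDenominator u)
      (1 + derivWithin (scatteringIntegral u zero_ne_two_fin) (Ici 0) k) (Ici 0) k :=
    fun k hk => (Complex.ofRealCLM.hasDerivAt.hasDerivWithinAt).add
      (hg.differentiableOn k hk).hasDerivWithinAt
  have hi := boundedDerivs_ringInverse hd
    ((boundedDerivs_const 1).add (hg.derivWithin (uniqueDiffOn_Ici 0)))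
    (fun k hk => (scatteringDenominator_ne_zero hs hgen hk).isUnit)
    (exists_norm_inverse_le hs hgen)
  exact (boundedDerivs_scatteringIntegral u one_ne_two_fin n).bilinear
    (ContinuousLinearMap.mul ℝ ℂ) hi

theorem rapidDecay_reflection : RapidDecay (reflection u) := by
  obtain ⟨C, hC⟩ := exists_norm_inverse_le hs hgen
  intro m
  obtain ⟨D, hD⟩ := rapidDecay_scatteringIntegral (u := u) m
  refine ⟨D * C, fun k hk => ?_⟩
  have hk0 : (0 : ℝ) ≤ k := hk
  rw [reflection, norm_mul, ← mul_assoc]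
  exact mul_le_mul (hD k hk) (hC k hk) (norm_nonneg _)
    (le_trans (by positivity) (hD k hk))

theorem contDiffOn_reflection : ContDiffOn ℝ ∞ (reflection u) (Ici 0) :=
  BoundedDerivs.contDiffOn (uniqueDiffOn_Ici 0) (boundedDerivs_reflection hs hgen)

theorem smoothRapidlyDecreasingOn_reflection :
    SmoothRapidlyDecreasingOn (reflection u) (Ioi 0) := by
  refine ⟨(contDiffOn_reflection hs hgen).mono Ioi_subset_Ici_self, fun m n => ?_⟩
  obtain ⟨C, hC⟩ := (rapidDecay_reflection hs hgen).bound_iteratedDeriv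
    (boundedDerivs_reflection hs hgen) m n
  exact ⟨C, fun k hk => by rw [abs_of_pos hk]; exact hC k hk⟩

theorem reflection_zero : reflection u 0 = om ^ 2 := by
  have h0 : scatteringIntegral u zero_ne_two_fin 0 ≠ 0 := by
    simpa [scatteringDenominator] using scatteringDenominator_ne_zero hs hgen le_rfl
  have h1 := scatteringIntegral_zero u zero_ne_two_fin one_ne_two_fin
  rw [lam_zero, lam_one] at h1
  rw [reflection, Ring.inverse_eq_inv', scatteringDenominator, Complex.ofReal_zero, zero_add,
    ← div_eq_mul_inv, div_eq_iff h0]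
  refine mul_left_cancel₀ (pow_ne_zero 2 om_ne_zero) ?_
  rw [← h1]
  ring

end Generic

end ReflectionCoefficients

end

end SawadaKotera

/-! ### The main theorem. -/

open SawadaKotera in
/-- Smoothness, decay and behaviour at `k = 0` of the reflection coefficients. Since
`sᴬ₁₁(k) = s₁₁(-k)` and `r₂(k) = ω r₁(-k)` for `k < 0`, the hypotheses on `sᴬ` follow from
those on `s`. -/
theorem theorem2p4 (u₀ : 𝓢(ℝ, ℝ))
    (hs : ∀ k : ℝ, 0 < k → SawadaKotera.s u₀ k 0 0 ≠ 0)
    (hsA : ∀ k : ℝ, k < 0 → SawadaKotera.sA u₀ k 0 0 ≠ 0)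
    (hgen : ¬ Tendsto (fun k : ℝ => (k : ℂ) * SawadaKotera.s u₀ k 0 0) (𝓝[>] 0) (𝓝 0))
    (hgenA : ¬ Tendsto (fun k : ℝ => (k : ℂ) * SawadaKotera.sA u₀ k 0 0) (𝓝[<] 0) (𝓝 0)) :
    (∀ k : ℝ, 0 < k → ∀ j : Fin 3, j ≠ 2 → ∃! v, SawadaKotera.IsJostColumn u₀ k j v) ∧
    (∀ k : ℝ, k < 0 → ∀ j : Fin 3, j ≠ 2 → ∃! v, SawadaKotera.IsCofactorJostColumn u₀ k j v) ∧
    SawadaKotera.SmoothRapidlyDecreasingOn (SawadaKotera.r₁ u₀) (Ioi 0) ∧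
    SawadaKotera.SmoothRapidlyDecreasingOn (SawadaKotera.r₂ u₀) (Iio 0) ∧
    SawadaKotera.ExtendsSmoothlyToZeroUnimodular (SawadaKotera.r₁ u₀) (Ioi 0) (SawadaKotera.om ^ 2) ∧
    SawadaKotera.ExtendsSmoothlyToZeroUnimodular (SawadaKotera.r₂ u₀) (Iio 0) 1 := by
  have hI : insert (0 : ℝ) (Ioi 0) = Ici 0 := Ioi_insert
  have hJ : insert (0 : ℝ) (Iio 0) = Iic 0 := Iio_insert
  have hsm := smoothRapidlyDecreasingOn_reflection hs hgen
  have hc := contDiffOn_reflection hs hgen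
  have e1 : EqOn (reflection u₀) (r₁ u₀) (Ioi 0) := fun k hk => (r₁_eq hk).symm
  have e2 : EqOn (fun k => om * reflection u₀ (-k)) (r₂ u₀) (Iio 0) := fun k hk => (r₂_eq hk).symm
  have hc1 : ContDiffOn ℝ ∞ (reflection u₀) (insert 0 (Ioi 0)) := by rwa [hI]
  have hc2 : ContDiffOn ℝ ∞ (fun k => om * reflection u₀ (-k)) (insert 0 (Iio 0)) := by
    rw [hJ]
    exact contDiffOn_const.mul (hc.comp contDiff_neg.contDiffOn fun k hk => by simpa using hk)
  refine ⟨fun k hk j hj => existsUnique_isJostColumn u₀ hj hk, fun k hk j hj => ?_,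
    hsm.congr isOpen_Ioi e1.symm, (hsm.reflect om).congr isOpen_Iio e2.symm,
    ⟨reflection u₀, e1, hc1, reflection_zero hs hgen, ?_, isBigO_taylor ?_ e1 hc1⟩,
    ⟨fun k => om * reflection u₀ (-k), e2, hc2, ?_, ?_, isBigO_taylor ?_ e2 hc2⟩⟩
  · refine existsUnique_isCofactorJostColumn u₀ k ?_
    have := existsUnique_isJostColumn u₀ hj (neg_pos.2 hk)
    rwa [Complex.ofReal_neg] at this
  · rw [reflection_zero hs hgen, norm_pow, norm_om, one_pow]
  · rw [hI]
    exact convex_Ici 0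
  -- The value of the extension of `r₂` at `0` is `ω · ω² = 1`.
  · simp only
    rw [neg_zero, reflection_zero hs hgen, ← pow_succ', om_cube]
  · simp only
    rw [neg_zero, reflection_zero hs hgen, ← pow_succ', om_cube, norm_one]
  · rw [hJ]
    exact convex_Iic 0
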